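/- **Setting.** A register is a finite-dimensional complex Hilbert space with a fixed orthonormal basis. A *Bell game* $G$ with alphabet size $n\ge 1$ is a two-player game whose input and output alphabets all equal $\{0,\dots,n-1\}$, whose inputs $(x,y)$ are uniformly distributed, whose score $L(x,y,s,t)$ lies in $[-1,1]$, and whose optimal classical expected score is $0$. An $N$-fold measurement strategy on a register $AB$ is a family of POVMs $\{F_{\mathbf u}^{\mathbf t}\}_{\mathbf t}$, one for each input string $\mathbf u=((x_1,y_1),\dots,(x_N,y_N))$, with outcomes the output strings $\mathbf t=((s_1,t_1),\dots,(s_N,t_N))$. It is *sequential* if, for every $i$, the operator $F_{\mathbf u}^{t_1\cdots t_i}$ obtained by summing over the last $N-i$ outputs depends only on the first $i$ inputs. For a history of $i<N$ rounds whose operator $M$ is nonzero, the *conditional strategy* of the next round is $M^{-1/2}M'M^{-1/2}$, where $M'$ is the operator of the history extended by the next input and output pairs and the inverse is taken on the support of $M$. A sequential strategy is *bipartite* if every conditional strategy has, on the support of $M$, the form $P_x^{s}\otimes R_y^{t}$ with POVMs $\{P_x^s\}_s$ on $A$ and $\{R_y^t\}_t$ on $B$ (compressed to that support). **Mirrored protocol.**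 Let $\delta>0$, $N\ge1$, let $G$ be a Bell game with alphabet size $n$, let $\Sigma$ be a state of $AB$, and let $F$ be a bipartite sequential measurement strategy on $AB$ for $N$ rounds of $G$. Registers $ABA'B'$ are prepared in the canonical purification of $\Sigma$, that is, in the pure state $(\sqrt{\Sigma}\otimes I)\sum_e e\otimes e$ (the sum is over the basis of $AB$). The input registers $\mathbf X,\mathbf Y$ of the referee are prepared in Bell states with copies $\mathbf X',\mathbf Y'$, which are given to the adversary. The referee measures $\mathbf X,\mathbf Y$ in the standard basis, and the devices measure $AB$ with $F$ on these inputs, producing outputs $\mathbf S,\mathbf T$; the event $succ$ is that the average score over the $N$ rounds is greater than $\delta$. The adversary measures $\mathbf X',\mathbf Y'$ in the standard basis and measures $A'B'$ with the entrywise complex conjugate $\overline F$ of $F$ on the inputs she obtained, producing outputs $\mathbf S',\mathbf T'$; the event $succ'$ is that her average score is at least $\delta$. **Proposition.** There is a universal constant $c>0$ such that, for all such $n,G,\delta,N,A,B,\Sigma,F$, $$\mathbf P\bigl((\mathbf S=\mathbf S')\wedge succ\wedge succ'\bigr)\le \exp\!\left(-c\,\frac{N\delta^6}{n^4}\right).$$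 -/

import Mathlib

noncomputable section

namespace MirrorProtocol

open scoped Kronecker Matrix ComplexOrder

/-! ### Games -/

/-- Expected score, for uniformly random inputs, of the deterministic strategy in which the first
player answers `f x` and the second player answers `g y`. -/
def classicalScore {n : ℕ} (L : Fin n → Fin n → Fin n → Fin n → ℝ) (f g : Fin n → Fin n) : ℝ :=
  (∑ x, ∑ y, L x y (f x) (g y)) / (n : ℝ) ^ 2

/-- A two-player Bell game with alphabet size `n`: all input and output alphabets are
`{0, …, n - 1}`, the inputs are uniform, `score x y s t` is the score of the outputs `s, t` on the
inputs `x, y` and lies in `[-1, 1]`, and the optimal classical score is `0`.  (A randomized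
classical strategy is a mixture of deterministic ones, so the optimum is attained at a
deterministic one.) -/
structure BellGame (n : ℕ) where
  score : Fin n → Fin n → Fin n → Fin n → ℝ
  score_mem : ∀ x y s t, score x y s t ∈ Set.Icc (-1 : ℝ) 1
  classical_optimum :
    IsGreatest {v : ℝ | ∃ f g : Fin n → Fin n, v = classicalScore score f g} 0

/-! ### States and measurements

A register is the Hilbert space with a fixed orthonormal basis indexed by a finite type `Q`; its
operators are the matrices `Matrix Q Q ℂ`, and the tensor product of the registers `Q` and `Q'` is
the register `Q × Q'`. -/

/-- `ρ` is a density operator. -/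
structure IsState {Q : Type*} [Fintype Q] (ρ : Matrix Q Q ℂ) : Prop where
  posSemidef : ρ.PosSemidef
  trace_eq_one : ρ.trace = 1

/-- `P` is a positive operator-valued measure with outcomes in `T`. -/
structure IsMeasurement {Q T : Type*} [Fintype Q] [DecidableEq Q] [Fintype T]
    (P : T → Matrix Q Q ℂ) : Prop where
  posSemidef : ∀ t, (P t).PosSemidef
  sum_eq_one : ∑ t, P t = 1

section Strategies

variable {Q U T : Type*} [Fintype Q] [DecidableEq Q] [Fintype T] [DecidableEq T] {N : ℕ}

/-- `F^{t₁ ⋯ tᵢ}_u`: the sum of `F u t'` over all output strings `t'` that agree with `t` in the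
first `i` rounds. -/
def marginal (F : (Fin N → U) → (Fin N → T) → Matrix Q Q ℂ) (i : ℕ)
    (u : Fin N → U) (t : Fin N → T) : Matrix Q Q ℂ :=
  ∑ t' : Fin N → T with ∀ j : Fin N, (j : ℕ) < i → t' j = t j, F u t'

/-- `F` is an `N`-fold sequential measurement strategy: a family of measurements, one for each
input string `u`, such that the operators for the first `i` outputs depend on the first `i` inputs
only. -/
structure IsSequential (F : (Fin N → U) → (Fin N → T) → Matrix Q Q ℂ) : Prop where
  isMeasurement : ∀ u, IsMeasurement (F u)
  nonanticipating : ∀ (i : ℕ) (u u' : Fin N → U), (∀ j : Fin N, (j : ℕ) < i → u j = u' j) →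
    ∀ t, marginal F i u t = marginal F i u' t

/-- `M^{-1/2}` for a positive semidefinite `M`, taken on the support of `M` (so it vanishes on the
kernel of `M`). -/
def invSqrt (M : Matrix Q Q ℂ) : Matrix Q Q ℂ := cfc (fun x : ℝ => (Real.sqrt x)⁻¹) M

/-- The orthogonal projector onto the support of a positive semidefinite `M`. -/
def supportProj (M : Matrix Q Q ℂ) : Matrix Q Q ℂ :=
  cfc (fun x : ℝ => if x = 0 then (0 : ℝ) else 1) M

/-- The conditional strategy for round `i` (counted from `0`), given the inputs and outputs
recorded in `u` and `t` for the earlier rounds: the operator for input `v` and output `w` is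
`M^{-1/2} M' M^{-1/2}`, where `M` is the operator for the first `i` rounds and `M'` is the one for
the first `i + 1` rounds. -/
def conditional (F : (Fin N → U) → (Fin N → T) → Matrix Q Q ℂ) (i : Fin N)
    (u : Fin N → U) (t : Fin N → T) (v : U) (w : T) : Matrix Q Q ℂ :=
  invSqrt (marginal F i u t) *
    marginal F (i + 1) (Function.update u i v) (Function.update t i w) *
    invSqrt (marginal F i u t)

end Strategies

section Protocol

variable {n N : ℕ}

/-- `F` is a bipartite sequential measurement strategy on the register `AB` for the `N`-fold game:
it is sequential and all its conditional strategies are bipartite.  A conditional strategy is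
a measurement on the support of the operator `M` of the history, so being bipartite means
being given there by `P x s ⊗ R y t` for measurements `P x` of `A` and `R y` of `B`. -/
structure IsBipartiteSequential {A B : Type*} [Fintype A] [DecidableEq A] [Fintype B]
    [DecidableEq B]
    (F : (Fin N → Fin n × Fin n) → (Fin N → Fin n × Fin n) → Matrix (A × B) (A × B) ℂ) :
    Prop where
  isSequential : IsSequential F
  bipartite : ∀ (i : Fin N) (u t : Fin N → Fin n × Fin n), marginal F i u t ≠ 0 →
    ∃ (P : Fin n → Fin n → Matrix A A ℂ) (R : Fin n → Fin n → Matrix B B ℂ),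
      (∀ x, IsMeasurement (P x)) ∧ (∀ y, IsMeasurement (R y)) ∧
      ∀ x y s t', conditional F i u t (x, y) (s, t') =
        supportProj (marginal F i u t) * (P x s ⊗ₖ R y t') * supportProj (marginal F i u t)

variable {Q : Type*} [Fintype Q] [DecidableEq Q]

/-- The unnormalized vector `∑ₑ e ⊗ e` of two copies of the register `Q`. -/
def diagVec (Q : Type*) [DecidableEq Q] : Q × Q → ℂ := fun p => if p.1 = p.2 then 1 else 0

/-- The canonical purification of a state `ρ` of `Q`: the projector onto the line spanned by the
unit vector `(√ρ ⊗ I) ∑ₑ e ⊗ e`. -/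
def canonicalPurification (ρ : Matrix Q Q ℂ) : Matrix (Q × Q) (Q × Q) ℂ :=
  let v := (cfc Real.sqrt ρ ⊗ₖ (1 : Matrix Q Q ℂ)) *ᵥ diagVec Q
  Matrix.vecMulVec v (star v)

/-- The Bell state (maximally entangled state) of two copies of the register `Q`. -/
def bellState (Q : Type*) [Fintype Q] [DecidableEq Q] : Matrix (Q × Q) (Q × Q) ℂ :=
  (Fintype.card Q : ℂ)⁻¹ • Matrix.vecMulVec (diagVec Q) (star (diagVec Q))

/-- The pairs of inputs, respectively of outputs, of the `N` rounds: `u i = (xᵢ, yᵢ)`,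
respectively `t i = (sᵢ, tᵢ)`. -/
abbrev Pairs (n N : ℕ) := Fin N → Fin n × Fin n

/-- The classical record of the protocol: the inputs and outputs `(x, y)` and `(s, t)` on the
devices' side, and those on the adversary's side. -/
structure Record (n N : ℕ) where
  inp : Pairs n N
  out : Pairs n N
  inp' : Pairs n N
  out' : Pairs n N

instance : Fintype (Record n N) :=
  Fintype.ofEquiv ((Pairs n N × Pairs n N) × (Pairs n N × Pairs n N))
    { toFun := fun p => ⟨p.1.1, p.1.2, p.2.1, p.2.2⟩
      invFun := fun r => ((r.inp, r.out), (r.inp', r.out'))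
      left_inv := fun _ => rfl
      right_inv := fun _ => rfl }

/-- The initial state: the input registers `XY` and their copies `X'Y'` are in a Bell state (all
the Bell pairs together form one Bell state of the whole strings), and `ABA'B'` is in the canonical
purification of `ρ`. -/
def initialState (n N : ℕ) (ρ : Matrix Q Q ℂ) :
    Matrix ((Pairs n N × Pairs n N) × (Q × Q)) ((Pairs n N × Pairs n N) × (Q × Q)) ℂ :=
  bellState (Pairs n N) ⊗ₖ canonicalPurification ρ

/-- The effect of a record: `XY` and `X'Y'` are measured in the standard basis, the devices measure
`AB` with `F` on the inputs of the referee, and the adversary measures `A'B'` with the entrywise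
complex conjugate of `F` on her inputs. -/
def recordEffect (F : Pairs n N → Pairs n N → Matrix Q Q ℂ) (r : Record n N) :
    Matrix ((Pairs n N × Pairs n N) × (Q × Q)) ((Pairs n N × Pairs n N) × (Q × Q)) ℂ :=
  (Matrix.single r.inp r.inp 1 ⊗ₖ Matrix.single r.inp' r.inp' 1) ⊗ₖ
    (F r.inp r.out ⊗ₖ (F r.inp' r.out').map (starRingEnd ℂ))

/-- The probability of a record in the mirrored protocol. -/
def recordProb (ρ : Matrix Q Q ℂ) (F : Pairs n N → Pairs n N → Matrix Q Q ℂ)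
    (r : Record n N) : ℝ :=
  (recordEffect F r * initialState n N ρ).trace.re

open Classical in
/-- The probability of an event `E` in the mirrored protocol. -/
def prob (ρ : Matrix Q Q ℂ) (F : Pairs n N → Pairs n N → Matrix Q Q ℂ)
    (E : Record n N → Prop) : ℝ :=
  ∑ r : Record n N with E r, recordProb ρ F r

/-- The average score over the `N` rounds. -/
def averageScore (G : BellGame n) (u t : Pairs n N) : ℝ :=
  (∑ i, G.score (u i).1 (u i).2 (t i).1 (t i).2) / N

/-- The referee considers the protocol to have succeeded: the average score exceeds `δ`. -/
def RefereeSucc (G : BellGame n) (δ : ℝ) (r : Record n N) : Prop :=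
  δ < averageScore G r.inp r.out

/-- The adversary considers the protocol to have succeeded: her average score is not less than
`δ`. -/
def AdversarySucc (G : BellGame n) (δ : ℝ) (r : Record n N) : Prop :=
  δ ≤ averageScore G r.inp' r.out'

/-- Alice's output string `s` equals the adversary's copy `s'` of it. -/
def SameOutput (r : Record n N) : Prop :=
  ∀ i, (r.out i).1 = (r.out' i).1

end Protocol

end MirrorProtocol

end

/-! The core is a one-round statement about an arbitrary vector shared by the devices and the
adversary. Let `a x`, `r y` be square roots of the measurements of Alice and Bob, and `b x` of the
adversary's measurement imitating Alice's; the three families commute with one another. Suppose `a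
x` and `b x` mostly agree. Then measuring `b x` disturbs everything that commutes with `a x` very
little, since `a x` itself leaves it unchanged and `b x` acts almost like `a x` (`le_conj_add`).
Hence the adversary can measure `b 0, b 1, …` one after another and obtain answers to all of Alice's
questions at once, nearly with the correct joint law with Bob (`score_le_word_score`). Predetermined
answers form a classical strategy, whose score is at most zero (`sum_word_score_nonpos`). If instead
`a x` and `b x` often disagree, requiring equal outputs loses probability directly.

`exp_moment_le` balances the two cases: on the event of equal outputs, the mean of `exp (l * (score
- δ))` over uniform inputs is at most `1 - δ ^ 2 / (32 * n ^ 2)` times the weight of the state.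

For `N` rounds, a history multiplies the shared vector by square roots of marginals, and the next
round is again local, by bipartiteness. As the one-round bound holds for every unnormalized vector,
it can be iterated history by history (`sum_roundFactor_mul_jointWeight_le`, `sum_prod_mul_le_pow`).
Markov's inequality for the exponential moment then gives `(1 - δ ^ 2 / (32 * n ^ 2)) ^ N`, which is
stronger than the stated estimate when `δ ≤ 1`; for `δ > 1` the event is empty. -/

namespace MirrorProtocol

open scoped Kronecker Matrix ComplexOrder

/-! ### Disturbance by agreeing measurements, for a positive functional on a star algebra. -/

section PositiveFunctional

variable {𝒜 : Type*} [Ring 𝒜] [StarRing 𝒜] [Algebra ℝ 𝒜] [StarModule ℝ 𝒜]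

/-- The cross terms of a positive functional are bounded by its diagonal terms. -/
lemma abs_cross_le {φ : 𝒜 →ₗ[ℝ] ℝ} (hφ : ∀ z, 0 ≤ φ (star z * z)) {u v : 𝒜}
    (hu : IsSelfAdjoint u) (hv : IsSelfAdjoint v) (d : 𝒜) {c : ℝ} (hc : 0 < c) :
    |φ (u * (star d * d) * v + v * (star d * d) * u)| ≤
      c⁻¹ * φ (u * (star d * d) * u) + c * φ (v * (star d * d) * v) := by
  -- Positivity of `φ` at `d * (u + r • v)`; the values `r = c` and `r = -c` bound the cross term
  -- from both sides.
  have key : ∀ r : ℝ, 0 ≤ φ (u * (star d * d) * u) +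
      r * φ (u * (star d * d) * v + v * (star d * d) * u) + r ^ 2 * φ (v * (star d * d) * v) := by
    intro r
    have h := hφ (d * u + r • (d * v))
    have e : star (d * u + r • (d * v)) * (d * u + r • (d * v)) =
        u * (star d * d) * u + r • (u * (star d * d) * v + v * (star d * d) * u) +
          r ^ 2 • (v * (star d * d) * v) := by
      simp only [star_add, star_smul, star_mul, hu.star_eq, hv.star_eq, star_trivial, add_mul,
        mul_add, smul_mul_assoc, mul_smul_comm, smul_add, mul_assoc, pow_two, mul_smul]
      abel
    rw [e] at h
    simpa only [map_add, map_smul, smul_eq_mul] using h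
  have h1 := key c
  have h2 := key (-c)
  set X := φ (u * (star d * d) * v + v * (star d * d) * u)
  set U := φ (u * (star d * d) * u)
  set V := φ (v * (star d * d) * v)
  have e : c * (c⁻¹ * U + c * V) = U + c ^ 2 * V := by field_simp
  rw [abs_le]
  constructor <;> refine le_of_mul_le_mul_left ?_ hc <;> nlinarith

/-- The weighted sum of a measurement whose effects are `star (d j) * d j`. -/
def weightedSum {J : Type*} [Fintype J] (w : J → ℝ) (d : J → 𝒜) : 𝒜 :=
  ∑ j, w j • (star (d j) * d j)

/-- Cauchy–Schwarz effect by effect: weights of modulus at most one only help, and the diagonal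
terms recombine because the effects sum to one. -/
lemma abs_weighted_cross_le {φ : 𝒜 →ₗ[ℝ] ℝ} (hφ : ∀ z, 0 ≤ φ (star z * z)) {u v : 𝒜}
    (hu : IsSelfAdjoint u) (hv : IsSelfAdjoint v) {J : Type*} [Fintype J] {w : J → ℝ}
    {d : J → 𝒜} (hw : ∀ j, |w j| ≤ 1) (hd : ∑ j, star (d j) * d j = 1) {c : ℝ} (hc : 0 < c) :
    |φ (u * weightedSum w d * v + v * weightedSum w d * u)| ≤
      c⁻¹ * φ (u * u) + c * φ (v * v) := by
  have e : u * weightedSum w d * v + v * weightedSum w d * u =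
      ∑ j, w j • (u * (star (d j) * d j) * v + v * (star (d j) * d j) * u) := by
    simp only [weightedSum, Finset.mul_sum, Finset.sum_mul, mul_smul_comm, smul_mul_assoc,
      smul_add, Finset.sum_add_distrib]
  have e1 : ∀ z : 𝒜, z * z = ∑ j, z * (star (d j) * d j) * z := by
    intro z
    rw [← Finset.sum_mul, ← Finset.mul_sum, hd, mul_one]
  rw [e, e1 u, e1 v, map_sum, map_sum, map_sum, Finset.mul_sum, Finset.mul_sum,
    ← Finset.sum_add_distrib]
  refine (Finset.abs_sum_le_sum_abs _ _).trans (Finset.sum_le_sum fun j _ => ?_)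
  rw [map_smul, smul_eq_mul, abs_mul]
  have h := abs_cross_le hφ hu hv (d j) hc
  have := mul_le_mul_of_nonneg_right (hw j) (abs_nonneg
    (φ (u * (star (d j) * d j) * v + v * (star (d j) * d j) * u)))
  linarith

/-- The probability, for a positive functional `φ`, that the commuting measurements with Kraus
operators `a` and `b` give different outcomes. -/
def disagreement {S : Type*} [Fintype S] (φ : 𝒜 →ₗ[ℝ] ℝ) (a b : S → 𝒜) : ℝ :=
  φ 1 - ∑ s, φ (a s * a s * (b s * b s))

/-- Two measurements that mostly agree disturb `φ` in nearly the same way; a weighted sum commuting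
with the first one is therefore nearly unchanged under the second one. -/
lemma le_conj_add {φ : 𝒜 →ₗ[ℝ] ℝ} (hφ : ∀ z, 0 ≤ φ (star z * z)) {S : Type*} [Fintype S]
    {a b : S → 𝒜} (ha : ∀ s, IsSelfAdjoint (a s)) (hb : ∀ s, IsSelfAdjoint (b s))
    (ha1 : ∑ s, a s * a s = 1) (hb1 : ∑ s, b s * b s = 1) (hab : ∀ s, Commute (a s) (b s))
    (hle : ∑ s, φ (a s * a s * (b s * b s)) ≤ ∑ s, φ (a s * b s))
    {J : Type*} [Fintype J] {w : J → ℝ} {d : J → 𝒜}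
    (hw : ∀ j, |w j| ≤ 1) (hd : ∑ j, star (d j) * d j = 1)
    (hcomm : ∀ s, Commute (a s) (weightedSum w d)) {c : ℝ} (hc : 0 < c) :
    0 ≤ disagreement φ a b ∧
    φ (weightedSum w d) ≤ φ (∑ s, b s * weightedSum w d * b s) +
      (disagreement φ a b / c + 2 * c * φ 1) := by
  set D := weightedSum w d
  have hu : ∀ s, IsSelfAdjoint (b s - a s) := fun s => (hb s).sub (ha s)
  have hv : ∀ s, IsSelfAdjoint (b s + a s) := fun s => (hb s).add (ha s)
  have hpos : ∀ {z : 𝒜}, IsSelfAdjoint z → 0 ≤ φ (z * z) := fun {z} hz => by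
    simpa [hz.star_eq] using hφ z
  have hsA : ∑ s, φ (a s * a s) = φ 1 := by rw [← map_sum, ha1]
  have hsB : ∑ s, φ (b s * b s) = φ 1 := by rw [← map_sum, hb1]
  have hU : ∑ s, φ ((b s - a s) * (b s - a s)) = 2 * φ 1 - 2 * ∑ s, φ (a s * b s) := by
    have : ∀ s, φ ((b s - a s) * (b s - a s)) =
        φ (b s * b s) + φ (a s * a s) - 2 * φ (a s * b s) := by
      intro s
      have : (b s - a s) * (b s - a s) = b s * b s + a s * a s - (2 : ℝ) • (a s * b s) := by
        rw [two_smul, sub_mul, mul_sub, mul_sub, (hab s).eq]; abel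
      rw [this]; simp
    simp only [this, Finset.sum_sub_distrib, Finset.sum_add_distrib, hsA, hsB, Finset.mul_sum]
    ring
  have hV : ∑ s, φ ((b s + a s) * (b s + a s)) = 2 * φ 1 + 2 * ∑ s, φ (a s * b s) := by
    have : ∀ s, φ ((b s + a s) * (b s + a s)) =
        φ (b s * b s) + φ (a s * a s) + 2 * φ (a s * b s) := by
      intro s
      have : (b s + a s) * (b s + a s) = b s * b s + a s * a s + (2 : ℝ) • (a s * b s) := by
        rw [two_smul, add_mul, mul_add, mul_add, (hab s).eq]; abel
      rw [this]; simp
    simp only [this, Finset.sum_add_distrib, hsA, hsB, Finset.mul_sum]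
    ring
  have hU0 : 0 ≤ ∑ s, φ ((b s - a s) * (b s - a s)) :=
    Finset.sum_nonneg fun s _ => hpos (hu s)
  -- Agreement enters here: by `hle` the overlap of the square roots is at least the agreement
  -- probability, so `a` and `b` are close in mean square.
  have hdis : ∑ s, φ ((b s - a s) * (b s - a s)) ≤ 2 * disagreement φ a b := by
    rw [hU, disagreement]; linarith
  refine ⟨by linarith, ?_⟩
  have hV4 : ∑ s, φ ((b s + a s) * (b s + a s)) ≤ 4 * φ 1 := by linarith
  -- Since `a s` commutes with `D`, also `D = ∑ s, a s * D * a s`; polarization then turns the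
  -- difference of the two conjugations into cross terms of `b s - a s` and `b s + a s`.
  have hdiff : 2 * (φ (∑ s, b s * D * b s) - φ D) =
      ∑ s, φ ((b s - a s) * D * (b s + a s) + (b s + a s) * D * (b s - a s)) := by
    have hD : D = ∑ s, a s * D * a s := by
      have : ∀ s, a s * D * a s = D * (a s * a s) := fun s => by
        rw [(hcomm s).eq, mul_assoc]
      simp only [this, ← Finset.mul_sum, ha1, mul_one]
    have : ∀ s, φ ((b s - a s) * D * (b s + a s) + (b s + a s) * D * (b s - a s)) =
        2 * φ (b s * D * b s) - 2 * φ (a s * D * a s) := by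
      intro s
      have : (b s - a s) * D * (b s + a s) + (b s + a s) * D * (b s - a s) =
          (2 : ℝ) • (b s * D * b s) - (2 : ℝ) • (a s * D * a s) := by
        simp only [two_smul, sub_mul, mul_sub, add_mul, mul_add]; abel
      rw [this]; simp
    simp only [this, Finset.sum_sub_distrib, ← Finset.mul_sum, ← map_sum]
    rw [← hD]; ring
  have hb' : |∑ s, φ ((b s - a s) * D * (b s + a s) + (b s + a s) * D * (b s - a s))| ≤
      c⁻¹ * ∑ s, φ ((b s - a s) * (b s - a s)) + c * ∑ s, φ ((b s + a s) * (b s + a s)) := by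
    rw [Finset.mul_sum, Finset.mul_sum, ← Finset.sum_add_distrib]
    exact (Finset.abs_sum_le_sum_abs _ _).trans
      (Finset.sum_le_sum fun s _ => abs_weighted_cross_le hφ (hu s) (hv s) hw hd hc)
  rw [← hdiff] at hb'
  have h1 := neg_abs_le (2 * (φ (∑ s, b s * D * b s) - φ D))
  have h2 : c⁻¹ * ∑ s, φ ((b s - a s) * (b s - a s)) ≤ c⁻¹ * (2 * disagreement φ a b) :=
    mul_le_mul_of_nonneg_left hdis (inv_pos.2 hc).le
  have h3 : c * ∑ s, φ ((b s + a s) * (b s + a s)) ≤ c * (4 * φ 1) :=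
    mul_le_mul_of_nonneg_left hV4 hc.le
  rw [div_eq_inv_mul]
  linarith

/-- The product `b 0 (f 0) * ⋯ * b (k - 1) (f (k - 1))`. -/
def word {k : ℕ} {S : Type*} (b : Fin k → S → 𝒜) (f : Fin k → S) : 𝒜 :=
  (List.ofFn fun x => b x (f x)).prod

omit [StarRing 𝒜] [Algebra ℝ 𝒜] [StarModule ℝ 𝒜] in
lemma word_cons {k : ℕ} {S : Type*} (b : Fin (k + 1) → S → 𝒜) (s : S) (f : Fin k → S) :
    word b (Fin.cons s f : Fin (k + 1) → S) = b 0 s * word (fun x => b x.succ) f := by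
  simp [word, List.ofFn_succ]

omit [StarRing 𝒜] [Algebra ℝ 𝒜] [StarModule ℝ 𝒜] in
lemma commute_word {k : ℕ} {S : Type*} {b : Fin k → S → 𝒜} {z : 𝒜}
    (h : ∀ x s, Commute z (b x s)) (f : Fin k → S) : Commute z (word b f) := by
  refine Commute.list_prod_right _ _ fun y hy => ?_
  obtain ⟨x, rfl⟩ := (List.mem_ofFn' _ _).1 hy
  exact h x _

omit [Algebra ℝ 𝒜] [StarModule ℝ 𝒜] in
-- The sum telescopes from the inside, the last factor first. This normalizes the sequential
-- measurement.
lemma sum_word_mul_star {k : ℕ} {S : Type*} [Fintype S] {b : Fin k → S → 𝒜}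
    (hb : ∀ x s, IsSelfAdjoint (b x s)) (hb1 : ∀ x, ∑ s, b x s * b x s = 1) :
    ∑ f, word b f * star (word b f) = 1 := by
  induction k with
  | zero => simp [word]
  | succ k ih =>
    rw [← (Fin.consEquiv fun _ => S).sum_comp, Fintype.sum_prod_type]
    simp only [Fin.consEquiv, Equiv.coe_fn_mk, word_cons, star_mul, (hb _ _).star_eq]
    have : ∀ s, ∑ f, b 0 s * word (fun x => b x.succ) f *
        (star (word (fun x => b x.succ) f) * b 0 s) = b 0 s * b 0 s := by
      intro s
      have h := ih (b := fun x => b x.succ) (fun x => hb _) (fun x => hb1 _)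
      calc _ = b 0 s * (∑ f, word (fun x => b x.succ) f * star (word (fun x => b x.succ) f))
            * b 0 s := by simp only [Finset.mul_sum, Finset.sum_mul, mul_assoc]
        _ = _ := by rw [h, mul_one]
    simp only [this, hb1]

end PositiveFunctional

/-! ### The one-round bound: from agreement to a classical strategy. -/

section PositiveFunctional

variable {𝒜 : Type*} [Ring 𝒜] [StarRing 𝒜] [Algebra ℝ 𝒜] [StarModule ℝ 𝒜]

/-- Measuring `b x` together with a commuting measurement `r` scores hardly more than reading off
the outcome of `b x` in the sequential measurement of `b 0, b 1, …`, provided that each `b x`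
mostly agrees with a measurement `a x` that commutes with all the others. -/
lemma score_le_word_score {φ : 𝒜 →ₗ[ℝ] ℝ} (hφ : ∀ z, 0 ≤ φ (star z * z)) {S T : Type*}
    [Fintype S] [Fintype T] {k : ℕ} {a b : Fin k → S → 𝒜} {r : T → 𝒜}
    (ha : ∀ x s, IsSelfAdjoint (a x s)) (hb : ∀ x s, IsSelfAdjoint (b x s))
    (hr : ∀ t, IsSelfAdjoint (r t))
    (ha1 : ∀ x, ∑ s, a x s * a x s = 1) (hb1 : ∀ x, ∑ s, b x s * b x s = 1)
    (hr1 : ∑ t, r t * r t = 1)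
    (hab : ∀ x s x' s', Commute (a x s) (b x' s')) (har : ∀ x s t, Commute (a x s) (r t))
    (hbr : ∀ x s t, Commute (b x s) (r t))
    (hle : ∀ x, ∑ s, φ (a x s * a x s * (b x s * b x s)) ≤ ∑ s, φ (a x s * b x s))
    {w : S → T → ℝ} (hw : ∀ s t, |w s t| ≤ 1) {c : ℝ} (hc : 0 < c) (x : Fin k) :
    ∑ s, ∑ t, w s t * φ (r t * r t * (b x s * b x s)) ≤
      ∑ f, ∑ t, w (f x) t * φ (word b f * (r t * r t) * star (word b f)) +
        ∑ x', (disagreement φ (a x') (b x') / c + 2 * c * φ 1) := by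
  induction k with
  | zero => exact x.elim0
  | succ k ih =>
    have hφ1 : 0 ≤ φ 1 := by simpa using hφ 1
    have hdis : ∀ x, 0 ≤ disagreement φ (a x) (b x) := fun x =>
      (le_conj_add (J := Unit) (w := 0) (d := 1) hφ (ha x) (hb x) (ha1 x) (hb1 x)
        (fun s => hab x s x s) (hle x) (by simp) (by simp) (by simp [weightedSum]) hc).1
    have herr : ∀ x, 0 ≤ disagreement φ (a x) (b x) / c + 2 * c * φ 1 := fun x => by
      have := hdis x; positivity
    set W : (Fin k → S) → 𝒜 := word fun x => b x.succ
    have hW1 : ∑ f, W f * star (W f) = 1 :=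
      sum_word_mul_star (fun x => hb _) (fun x => hb1 _)
    rw [← (Fin.consEquiv fun _ => S).sum_comp, Fintype.sum_prod_type]
    simp only [Fin.consEquiv, Equiv.coe_fn_mk, word_cons, star_mul, (hb _ _).star_eq]
    rcases Fin.eq_zero_or_eq_succ x with rfl | ⟨j, rfl⟩
    -- `b 0` is measured first, hence on the undisturbed state; the later factors commute with `r t`
    -- and sum to one.
    · simp only [Fin.cons_zero]
      have e : ∀ s, ∑ f, ∑ t, w s t * φ (b 0 s * W f * (r t * r t) * (star (W f) * b 0 s)) =
          ∑ t, w s t * φ (r t * r t * (b 0 s * b 0 s)) := by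
        intro s
        rw [Finset.sum_comm]
        refine Finset.sum_congr rfl fun t _ => ?_
        rw [← Finset.mul_sum, ← map_sum]
        have hc1 : ∀ f, Commute (W f) (r t * r t) := fun f =>
          have h : Commute (W f) (r t) := (commute_word (fun x s => (hbr x.succ s t).symm) f).symm
          h.mul_right h
        have hc2 : Commute (b 0 s) (r t * r t) := (hbr 0 s t).mul_right (hbr 0 s t)
        have : ∀ f, b 0 s * W f * (r t * r t) * (star (W f) * b 0 s) =
            r t * r t * b 0 s * (W f * star (W f)) * b 0 s := by
          intro f
          rw [mul_assoc (b 0 s), (hc1 f).eq, ← mul_assoc (b 0 s), hc2.eq]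
          simp only [mul_assoc]
        simp only [this, ← Finset.mul_sum, ← Finset.sum_mul, hW1, mul_one]
        simp only [mul_assoc]
      show _ ≤ ∑ s, ∑ f, ∑ t, w s t * φ (b 0 s * W f * (r t * r t) * (star (W f) * b 0 s)) + _
      simp only [e]
      exact le_add_of_nonneg_right (Finset.sum_nonneg fun x _ => herr x)
    -- By induction the score is controlled by the measurement of the tail. Its score observable
    -- commutes with `a 0 s`, so putting `b 0` in front costs one disturbance term.
    · simp only [Fin.cons_succ]
      have h1 := ih (a := fun x => a x.succ) (b := fun x => b x.succ) (fun x => ha _)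
        (fun x => hb _) (fun x => ha1 _) (fun x => hb1 _) (fun x s x' s' => hab _ _ _ _)
        (fun x => har _) (fun x => hbr _) (fun x => hle _) j
      let d : (Fin k → S) × T → 𝒜 := fun p => r p.2 * star (W p.1)
      let v : (Fin k → S) × T → ℝ := fun p => w (p.1 j) p.2
      have hdd : ∀ p, star (d p) * d p = W p.1 * (r p.2 * r p.2) * star (W p.1) := fun p => by
        simp only [d, star_mul, star_star, (hr _).star_eq, mul_assoc]
      have hd1 : ∑ p, star (d p) * d p = 1 := by
        simp only [hdd, Fintype.sum_prod_type, ← Finset.mul_sum, ← Finset.sum_mul, hr1, mul_one,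
          hW1]
      have hcomm : ∀ s, Commute (a 0 s) (weightedSum v d) := by
        intro s
        refine Commute.sum_right _ _ _ fun p _ => ?_
        rw [hdd]
        have hc1 : Commute (a 0 s) (W p.1) := commute_word (fun x s' => hab _ _ _ _) _
        have hc2 : Commute (a 0 s) (star (W p.1)) := by
          simpa [(ha 0 s).star_eq] using hc1.star_star
        exact ((hc1.mul_right ((har _ _ _).mul_right (har _ _ _))).mul_right hc2).smul_right _
      have h2 := (le_conj_add hφ (ha 0) (hb 0) (ha1 0) (hb1 0) (fun s => hab _ _ _ _) (hle 0)
        (w := v) (fun p => hw _ _) hd1 hcomm hc).2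
      have e1 : φ (weightedSum v d) =
          ∑ f, ∑ t, w (f j) t * φ (W f * (r t * r t) * star (W f)) := by
        simp only [weightedSum, hdd, map_sum, map_smul, smul_eq_mul, Fintype.sum_prod_type, v]
      have e2 : φ (∑ s, b 0 s * weightedSum v d * b 0 s) =
          ∑ s, ∑ f, ∑ t, w (f j) t * φ (b 0 s * W f * (r t * r t) * (star (W f) * b 0 s)) := by
        simp only [weightedSum, hdd, Finset.mul_sum, Finset.sum_mul, map_sum, map_smul,
          smul_eq_mul, Fintype.sum_prod_type, v, mul_smul_comm, smul_mul_assoc, mul_assoc]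
      rw [Fin.sum_univ_succ]
      rw [e1, e2] at h2
      linarith

omit [StarModule ℝ 𝒜] in
/-- The sequential measurement of all inputs of the first player is a classical strategy. -/
lemma sum_word_score_nonpos {n : ℕ} (hn : 0 < n) (G : BellGame n) {φ : 𝒜 →ₗ[ℝ] ℝ}
    (hφ : ∀ z, 0 ≤ φ (star z * z)) (b : Fin n → Fin n → 𝒜) {r : Fin n → Fin n → 𝒜}
    (hr : ∀ y t, IsSelfAdjoint (r y t)) (hr1 : ∀ y, ∑ t, r y t * r y t = 1) :
    ∑ x, ∑ y, ∑ f, ∑ t, G.score x y (f x) t *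
      φ (word b f * (r y t * r y t) * star (word b f)) ≤ 0 := by
  have hne : Nonempty (Fin n) := ⟨⟨0, hn⟩⟩
  have e : ∑ x, ∑ y, ∑ f, ∑ t, G.score x y (f x) t *
      φ (word b f * (r y t * r y t) * star (word b f)) =
      ∑ f : Fin n → Fin n, ∑ y, ∑ t, (∑ x, G.score x y (f x) t) *
        φ (word b f * (r y t * r y t) * star (word b f)) := by
    simp only [Finset.sum_mul]
    calc _ = ∑ x, ∑ f : Fin n → Fin n, ∑ y, ∑ t, G.score x y (f x) t *
          φ (word b f * (r y t * r y t) * star (word b f)) :=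
        Finset.sum_congr rfl fun x _ => Finset.sum_comm
      _ = ∑ f : Fin n → Fin n, ∑ x, ∑ y, ∑ t, G.score x y (f x) t *
          φ (word b f * (r y t * r y t) * star (word b f)) := Finset.sum_comm
      _ = _ := by
        refine Finset.sum_congr rfl fun f _ => ?_
        rw [Finset.sum_comm]
        exact Finset.sum_congr rfl fun y _ => Finset.sum_comm
  rw [e]
  refine Finset.sum_nonpos fun f _ => ?_
  -- With all of the first player's answers fixed to `f`, the second player can do no better than a
  -- deterministic best reply.
  choose g hg using fun y => Finite.exists_max fun t => ∑ x, G.score x y (f x) t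
  have hpos : ∀ y t, 0 ≤ φ (word b f * (r y t * r y t) * star (word b f)) := by
    intro y t
    have := hφ (r y t * star (word b f))
    simpa only [star_mul, star_star, (hr y t).star_eq, mul_assoc] using this
  have hsum : ∀ y, ∑ t, φ (word b f * (r y t * r y t) * star (word b f)) =
      φ (word b f * star (word b f)) := by
    intro y
    rw [← map_sum, ← Finset.sum_mul, ← Finset.mul_sum, hr1, mul_one]
  have hclass : ∑ y, ∑ x, G.score x y (f x) (g y) ≤ 0 := by
    have h : classicalScore G.score f g ≤ 0 := G.classical_optimum.2 ⟨f, g, rfl⟩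
    have hn2 : (0 : ℝ) < (n : ℝ) ^ 2 := by positivity
    rw [Finset.sum_comm]
    by_contra hcon
    exact absurd h (not_le.2 (div_pos (not_le.1 hcon) hn2))
  have hW : 0 ≤ φ (word b f * star (word b f)) := by simpa using hφ (star (word b f))
  calc _ ≤ ∑ y, ∑ t, (∑ x, G.score x y (f x) (g y)) *
        φ (word b f * (r y t * r y t) * star (word b f)) :=
      Finset.sum_le_sum fun y _ => Finset.sum_le_sum fun t _ =>
        mul_le_mul_of_nonneg_right (hg y t) (hpos y t)
    _ = (∑ y, ∑ x, G.score x y (f x) (g y)) * φ (word b f * star (word b f)) := by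
      rw [Finset.sum_mul]
      simp only [← Finset.mul_sum, hsum]
    _ ≤ 0 := mul_nonpos_of_nonpos_of_nonneg hclass hW

/-- The one-round bound: the exponential moment of the score, on the event that the outputs of the
commuting measurements `a x` and `b x` agree. -/
lemma exp_moment_le {n : ℕ} (hn : 0 < n) (G : BellGame n) {φ : 𝒜 →ₗ[ℝ] ℝ}
    (hφ : ∀ z, 0 ≤ φ (star z * z)) {a b r : Fin n → Fin n → 𝒜}
    (ha : ∀ x s, IsSelfAdjoint (a x s)) (hb : ∀ x s, IsSelfAdjoint (b x s))
    (hr : ∀ y t, IsSelfAdjoint (r y t))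
    (ha1 : ∀ x, ∑ s, a x s * a x s = 1) (hb1 : ∀ x, ∑ s, b x s * b x s = 1)
    (hr1 : ∀ y, ∑ t, r y t * r y t = 1)
    (hab : ∀ x s x' s', Commute (a x s) (b x' s'))
    (har : ∀ x s y t, Commute (a x s) (r y t))
    (hbr : ∀ x s y t, Commute (b x s) (r y t))
    (hle : ∀ x, ∑ s, φ (a x s * a x s * (b x s * b x s)) ≤ ∑ s, φ (a x s * b x s))
    {δ : ℝ} (hδ : 0 < δ) (hδ1 : δ ≤ 1) :
    ∑ x, ∑ y, ∑ s, ∑ t, Real.exp (δ / (16 * n ^ 2) * (G.score x y s t - δ)) *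
      φ (a x s * a x s * (r y t * r y t) * (b x s * b x s)) ≤
      n ^ 2 * φ 1 * (1 - δ ^ 2 / (32 * n ^ 2)) := by
  have hn1 : (1 : ℝ) ≤ n := by exact_mod_cast hn
  have hn2 : (1 : ℝ) ≤ (n : ℝ) ^ 2 := one_le_pow₀ hn1
  -- The minimizer of `-l * δ + 8 * l ^ 2 * n ^ 2`, the correction that remains at the end.
  set l : ℝ := δ / (16 * n ^ 2) with hl
  have hl0 : 0 < l := by positivity
  have hl1 : l ≤ 1 / 16 := by
    rw [hl, div_le_div_iff₀ (by positivity) (by norm_num)]; nlinarith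
  have hφ1 : 0 ≤ φ 1 := by simpa using hφ 1
  set q : Fin n → Fin n → Fin n → Fin n → ℝ := fun x y s t =>
    φ (a x s * a x s * (r y t * r y t) * (b x s * b x s)) with hq
  have hpos : ∀ x y s s' t, 0 ≤ φ (a x s' * a x s' * (r y t * r y t) * (b x s * b x s)) := by
    intro x y s s' t
    have h := hφ (a x s' * r y t * b x s)
    have e : star (a x s' * r y t * b x s) * (a x s' * r y t * b x s) =
        a x s' * a x s' * (r y t * r y t) * (b x s * b x s) := by
      simp only [star_mul, (ha _ _).star_eq, (hb _ _).star_eq, (hr _ _).star_eq]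
      calc b x s * (r y t * a x s') * (a x s' * r y t * b x s)
          = b x s * ((r y t * (a x s' * a x s')) * r y t * b x s) := by simp only [mul_assoc]
        _ = b x s * (a x s' * a x s' * (r y t * r y t) * b x s) := by
          rw [← ((har x s' y t).mul_left (har x s' y t)).eq]; simp only [mul_assoc]
        _ = (b x s * (a x s' * a x s' * (r y t * r y t))) * b x s := by simp only [mul_assoc]
        _ = _ := by
          have h1 : Commute (b x s) (a x s') := (hab _ _ _ _).symm
          rw [((h1.mul_right h1).mul_right ((hbr x s y t).mul_right (hbr x s y t))).eq]
          simp only [mul_assoc]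
    rwa [e] at h
  have hscore : ∀ x y s t, |G.score x y s t| ≤ 1 := fun x y s t => abs_le.2 (G.score_mem x y s t)
  have hε : ∀ x, 0 ≤ disagreement φ (a x) (b x) := fun x =>
    (le_conj_add (J := Unit) (w := 0) (d := 1) hφ (ha x) (hb x) (ha1 x) (hb1 x)
      (fun s => hab x s x s) (hle x) (by simp) (by simp) (by simp [weightedSum]) one_pos).1
  set E := ∑ x, disagreement φ (a x) (b x) with hE
  have hE0 : 0 ≤ E := Finset.sum_nonneg fun x _ => hε x
  -- total weight
  have hsumt : ∀ x y s, ∑ t, q x y s t = φ (a x s * a x s * (b x s * b x s)) := by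
    intro x y s
    rw [← map_sum, ← Finset.sum_mul, ← Finset.mul_sum, hr1, mul_one]
  have hsumq : ∀ x y, ∑ s, ∑ t, q x y s t = φ 1 - disagreement φ (a x) (b x) := by
    intro x y
    simp only [hsumt, disagreement, sub_sub_cancel]
  have htot : ∑ x, ∑ y, ∑ s, ∑ t, q x y s t = n ^ 2 * φ 1 - n * E := by
    simp only [hsumq, Finset.sum_const, Finset.card_univ, Fintype.card_fin, nsmul_eq_mul,
      ← Finset.mul_sum, Finset.sum_sub_distrib]
    ring
  -- total score
  have hdrop : ∀ x y, ∑ s, ∑ t, G.score x y s t * q x y s t ≤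
      ∑ s, ∑ t, G.score x y s t * φ (r y t * r y t * (b x s * b x s)) +
        disagreement φ (a x) (b x) := by
    intro x y
    have hrb : ∀ s t, q x y s t ≤ φ (r y t * r y t * (b x s * b x s)) := by
      intro s t
      have : φ (r y t * r y t * (b x s * b x s)) =
          ∑ s', φ (a x s' * a x s' * (r y t * r y t) * (b x s * b x s)) := by
        rw [← map_sum, ← Finset.sum_mul, ← Finset.sum_mul, ha1, one_mul]
      rw [this]
      exact Finset.single_le_sum
        (f := fun s' => φ (a x s' * a x s' * (r y t * r y t) * (b x s * b x s)))
        (fun s' _ => hpos x y s s' t) (Finset.mem_univ s)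
    have htotal : ∑ s, ∑ t, φ (r y t * r y t * (b x s * b x s)) = φ 1 := by
      simp only [← map_sum, ← Finset.sum_mul, hr1, one_mul, hb1]
    have hdis : disagreement φ (a x) (b x) =
        ∑ s, ∑ t, (φ (r y t * r y t * (b x s * b x s)) - q x y s t) := by
      simp only [Finset.sum_sub_distrib, htotal, hsumq, sub_sub_cancel]
    rw [hdis, ← Finset.sum_add_distrib]
    refine Finset.sum_le_sum fun s _ => ?_
    rw [← Finset.sum_add_distrib]
    refine Finset.sum_le_sum fun t _ => ?_
    have h1 := hrb s t
    have h2 := (abs_le.1 (hscore x y s t)).1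
    nlinarith
  -- With this parameter the disturbance contributes `n * E / 2` after multiplication by `l`, half
  -- of the mass `n * E` lost to disagreement.
  have hc : (0 : ℝ) < 2 * n * l := by positivity
  have hscoretot : ∑ x, ∑ y, ∑ s, ∑ t, G.score x y s t * q x y s t ≤
      n * E + n ^ 2 * (E / (2 * n * l) + n * (2 * (2 * n * l) * φ 1)) := by
    have herr : ∑ x, (disagreement φ (a x) (b x) / (2 * n * l) + 2 * (2 * n * l) * φ 1) =
        E / (2 * n * l) + n * (2 * (2 * n * l) * φ 1) := by
      rw [Finset.sum_add_distrib, ← Finset.sum_div]; simp [hE]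
    have h1 : ∀ x y, ∑ s, ∑ t, G.score x y s t * q x y s t ≤
        ∑ f, ∑ t, G.score x y (f x) t * φ (word b f * (r y t * r y t) * star (word b f)) +
          (E / (2 * n * l) + n * (2 * (2 * n * l) * φ 1)) + disagreement φ (a x) (b x) := by
      intro x y
      have := score_le_word_score hφ ha hb (hr y) ha1 hb1 (hr1 y) hab
        (fun x s => har x s y) (fun x s => hbr x s y) hle (w := G.score x y) (hscore x y) hc x
      rw [herr] at this
      linarith [hdrop x y]
    refine (Finset.sum_le_sum fun x _ => Finset.sum_le_sum fun y _ => h1 x y).trans ?_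
    have h2 := sum_word_score_nonpos hn G hφ b hr hr1
    simp only [Finset.sum_add_distrib, Finset.sum_const, Finset.card_univ, Fintype.card_fin,
      nsmul_eq_mul, ← Finset.mul_sum]
    rw [← hE]
    nlinarith
  -- The bound `exp z ≤ 1 + z + z ^ 2`, with `|z| ≤ 2 * l` because scores and `δ` are at most one in
  -- modulus.
  have hexp : ∀ x y s t, Real.exp (l * (G.score x y s t - δ)) * q x y s t ≤
      l * (G.score x y s t * q x y s t) + (1 - l * δ + 4 * l ^ 2) * q x y s t := by
    intro x y s t
    have hs := abs_le.1 (hscore x y s t)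
    have hz : |l * (G.score x y s t - δ)| ≤ 2 * l := by
      rw [abs_mul, abs_of_pos hl0, mul_comm]
      refine mul_le_mul_of_nonneg_right (abs_le.2 ⟨by linarith, by linarith⟩) hl0.le
    have h1 := (abs_le.1 (Real.abs_exp_sub_one_sub_id_le (hz.trans (by linarith)))).2
    have h2 : (l * (G.score x y s t - δ)) ^ 2 ≤ (2 * l) ^ 2 := sq_le_sq' (by
      linarith [(abs_le.1 hz).1]) (abs_le.1 hz).2
    have h3 : Real.exp (l * (G.score x y s t - δ)) ≤
        l * G.score x y s t + (1 - l * δ + 4 * l ^ 2) := by nlinarith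
    have := mul_le_mul_of_nonneg_right h3 (hpos x y s s t)
    linarith
  calc _ ≤ ∑ x, ∑ y, ∑ s, ∑ t, (l * (G.score x y s t * q x y s t) +
        (1 - l * δ + 4 * l ^ 2) * q x y s t) :=
      Finset.sum_le_sum fun x _ => Finset.sum_le_sum fun y _ => Finset.sum_le_sum fun s _ =>
        Finset.sum_le_sum fun t _ => hexp x y s t
    _ = l * (∑ x, ∑ y, ∑ s, ∑ t, G.score x y s t * q x y s t) +
        (1 - l * δ + 4 * l ^ 2) * (n ^ 2 * φ 1 - n * E) := by
      rw [← htot]; simp only [Finset.sum_add_distrib, Finset.mul_sum]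
    _ ≤ l * (n * E + n ^ 2 * (E / (2 * n * l) + n * (2 * (2 * n * l) * φ 1))) +
        (1 - l * δ + 4 * l ^ 2) * (n ^ 2 * φ 1 - n * E) := by gcongr
    _ = n ^ 2 * φ 1 * (1 - l * δ + 4 * l ^ 2 + 4 * l ^ 2 * n ^ 2) -
        n * E * (1 / 2 - l * δ + 4 * l ^ 2 - l) := by field_simp; ring
    -- Disagreement only lowers the moment: its net coefficient is nonpositive, as `l ≤ 1 / 16` and
    -- `δ ≤ 1`.
    _ ≤ n ^ 2 * φ 1 * (1 - l * δ + 4 * l ^ 2 + 4 * l ^ 2 * n ^ 2) := by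
      have h1 : l * δ ≤ l := by nlinarith
      have : 0 ≤ n * E * (1 / 2 - l * δ + 4 * l ^ 2 - l) :=
        mul_nonneg (by positivity) (by nlinarith)
      linarith
    _ ≤ n ^ 2 * φ 1 * (1 - l * δ + 8 * l ^ 2 * n ^ 2) := by
      refine mul_le_mul_of_nonneg_left ?_ (by positivity)
      nlinarith [sq_nonneg l]
    _ = _ := by rw [hl]; field_simp; ring

end PositiveFunctional

/-! ### Vector functionals and square roots of effects. -/

section Matrices

variable {Q : Type*} [Fintype Q]

/-- The expectation functional of the (unnormalized) pure state `v`. -/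
def expectation (v : Q → ℂ) : Matrix Q Q ℂ →ₗ[ℝ] ℝ where
  toFun Z := (star v ⬝ᵥ Z *ᵥ v).re
  map_add' := by simp [Matrix.add_mulVec, dotProduct_add]
  map_smul' := by simp [Matrix.smul_mulVec, dotProduct_smul]

lemma expectation_nonneg (v : Q → ℂ) {Z : Matrix Q Q ℂ} (hZ : Z.PosSemidef) :
    0 ≤ expectation v Z :=
  (Complex.le_def.1 (hZ.dotProduct_mulVec_nonneg v)).1

lemma expectation_star_mul_self_nonneg (v : Q → ℂ) (Z : Matrix Q Q ℂ) :
    0 ≤ expectation v (star Z * Z) :=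
  expectation_nonneg v (Matrix.posSemidef_conjTranspose_mul_self Z)

/-- Used to absorb the past rounds into an unnormalized vector. -/
lemma expectation_conj (v : Q → ℂ) (Z C : Matrix Q Q ℂ) :
    expectation v (Cᴴ * Z * C) = expectation (C *ᵥ v) Z := by
  simp only [expectation, LinearMap.coe_mk, AddHom.coe_mk, Matrix.star_mulVec,
    Matrix.dotProduct_mulVec, Matrix.vecMul_vecMul]

variable [DecidableEq Q]

open scoped MatrixOrder in
-- On `[0, 1]` one has `x ≤ √x`. The last property is what makes the overlap of square roots
-- dominate the agreement probability.
lemma exists_posSemidef_sqrt {p : Matrix Q Q ℂ} (hp : p.PosSemidef) (hp1 : (1 - p).PosSemidef) :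
    ∃ a : Matrix Q Q ℂ, a.PosSemidef ∧ a * a = p ∧ (a - a * a).PosSemidef := by
  have h0 : 0 ≤ p := Matrix.nonneg_iff_posSemidef.2 hp
  have hsa : IsSelfAdjoint p := hp.1
  have hspec0 : ∀ x ∈ spectrum ℝ p, 0 ≤ x := fun x hx => spectrum_nonneg_of_nonneg h0 hx
  have hspec1 : ∀ x ∈ spectrum ℝ p, x ≤ 1 :=
    (CFC.le_one_iff (R := ℝ) p hsa).1 (Matrix.le_iff.2 hp1)
  have hsq : cfc Real.sqrt p * cfc Real.sqrt p = p := by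
    rw [← cfc_mul Real.sqrt Real.sqrt p]
    conv_rhs => rw [← cfc_id ℝ p]
    exact cfc_congr fun x hx => Real.mul_self_sqrt (hspec0 x hx)
  refine ⟨cfc Real.sqrt p, ?_, hsq, ?_⟩
  · exact Matrix.nonneg_iff_posSemidef.1 (cfc_nonneg fun x _ => Real.sqrt_nonneg x)
  · rw [hsq]
    refine Matrix.le_iff.1 ?_
    conv_lhs => rw [← cfc_id ℝ p]
    refine cfc_mono fun x hx => ?_
    exact Real.le_sqrt_of_sq_le (by have := hspec0 x hx; have := hspec1 x hx; simp; nlinarith)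

lemma IsMeasurement.one_sub_posSemidef {T : Type*} [Fintype T] {P : T → Matrix Q Q ℂ}
    (hP : IsMeasurement P) (t : T) : (1 - P t).PosSemidef := by
  classical
  rw [← hP.sum_eq_one, ← Finset.sum_erase_eq_sub (Finset.mem_univ t)]
  exact Matrix.posSemidef_sum _ fun s _ => hP.posSemidef s

omit [Fintype Q] [DecidableEq Q] in
lemma posSemidef_map_conj {M : Matrix Q Q ℂ} (hM : M.PosSemidef) :
    (M.map (starRingEnd ℂ)).PosSemidef := by
  have : M.map (starRingEnd ℂ) = Mᵀ := by
    conv_rhs => rw [← hM.1.eq]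
    rfl
  rw [this]
  exact hM.transpose

lemma IsMeasurement.map_conj {T : Type*} [Fintype T] {P : T → Matrix Q Q ℂ}
    (hP : IsMeasurement P) : IsMeasurement fun t => (P t).map (starRingEnd ℂ) where
  posSemidef t := posSemidef_map_conj (hP.posSemidef t)
  sum_eq_one := by
    have h := congrArg (fun M : Matrix Q Q ℂ => M.map (starRingEnd ℂ)) hP.sum_eq_one
    rw [Matrix.map_one _ (map_zero _) (map_one _)] at h
    rw [← h]
    ext i j
    simp [Matrix.sum_apply]

lemma IsMeasurement.exists_sqrt {X T : Type*} [Fintype T] {P : X → T → Matrix Q Q ℂ}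
    (hP : ∀ x, IsMeasurement (P x)) :
    ∃ a : X → T → Matrix Q Q ℂ, (∀ x t, (a x t).PosSemidef) ∧ (∀ x t, a x t * a x t = P x t) ∧
      ∀ x t, (a x t - a x t * a x t).PosSemidef := by
  choose a h1 h2 h3 using fun x t =>
    exists_posSemidef_sqrt ((hP x).posSemidef t) ((hP x).one_sub_posSemidef t)
  exact ⟨a, h1, h2, h3⟩

omit [Fintype Q] [DecidableEq Q] in
lemma kronecker_sum {Q' T : Type*} (s : Finset T) (M : Matrix Q Q ℂ)
    (f : T → Matrix Q' Q' ℂ) : M ⊗ₖ (∑ t ∈ s, f t) = ∑ t ∈ s, M ⊗ₖ f t := by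
  ext i j
  simp [Matrix.sum_apply, Finset.mul_sum]

omit [Fintype Q] [DecidableEq Q] in
lemma sum_kronecker {Q' T : Type*} (s : Finset T) (f : T → Matrix Q Q ℂ)
    (M : Matrix Q' Q' ℂ) : (∑ t ∈ s, f t) ⊗ₖ M = ∑ t ∈ s, f t ⊗ₖ M := by
  ext i j
  simp [Matrix.sum_apply, Finset.sum_mul]

omit [Fintype Q] [DecidableEq Q] in
lemma map_conj_kronecker {Q' : Type*} (M : Matrix Q Q ℂ) (M' : Matrix Q' Q' ℂ) :
    (M ⊗ₖ M').map (starRingEnd ℂ) = M.map (starRingEnd ℂ) ⊗ₖ M'.map (starRingEnd ℂ) := by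
  ext i j
  simp

end Matrices

/-- The one-round bound for two devices that play with the local measurements `P, R` and `P', R'`
on the two halves of an arbitrary bipartite vector. -/
lemma exp_moment_kronecker_le {n : ℕ} (hn : 0 < n) (G : BellGame n) {A B : Type*} [Fintype A]
    [DecidableEq A] [Fintype B] [DecidableEq B] {P P' : Fin n → Fin n → Matrix A A ℂ}
    {R R' : Fin n → Fin n → Matrix B B ℂ} (hP : ∀ x, IsMeasurement (P x))
    (hP' : ∀ x, IsMeasurement (P' x)) (hR : ∀ y, IsMeasurement (R y))
    (hR' : ∀ y, IsMeasurement (R' y)) (v : (A × B) × (A × B) → ℂ)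
    {δ : ℝ} (hδ : 0 < δ) (hδ1 : δ ≤ 1) :
    ∑ x, ∑ y, ∑ s, ∑ t, ∑ t', Real.exp (δ / (16 * n ^ 2) * (G.score x y s t - δ)) *
      expectation v ((P x s ⊗ₖ R y t) ⊗ₖ (P' x s ⊗ₖ R' y t').map (starRingEnd ℂ)) ≤
      n ^ 2 * expectation v 1 * (1 - δ ^ 2 / (32 * n ^ 2)) := by
  obtain ⟨α, hα, hαP, hα1⟩ := IsMeasurement.exists_sqrt hP
  obtain ⟨β, hβ, hβP, hβ1⟩ := IsMeasurement.exists_sqrt hR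
  obtain ⟨γ, hγ, hγP, hγ1⟩ := IsMeasurement.exists_sqrt fun x => (hP' x).map_conj
  set a : Fin n → Fin n → Matrix ((A × B) × (A × B)) ((A × B) × (A × B)) ℂ :=
    fun x s => (α x s ⊗ₖ 1) ⊗ₖ 1 with ha
  set r : Fin n → Fin n → Matrix ((A × B) × (A × B)) ((A × B) × (A × B)) ℂ :=
    fun y t => (1 ⊗ₖ β y t) ⊗ₖ 1 with hr
  set b : Fin n → Fin n → Matrix ((A × B) × (A × B)) ((A × B) × (A × B)) ℂ :=
    fun x s => 1 ⊗ₖ (γ x s ⊗ₖ 1) with hb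
  have hself : ∀ {K : Type _} [Fintype K] {M : Matrix K K ℂ}, M.PosSemidef → IsSelfAdjoint M :=
    fun h => h.1
  have hle : ∀ x, ∑ s, expectation v (a x s * a x s * (b x s * b x s)) ≤
      ∑ s, expectation v (a x s * b x s) := by
    intro x
    refine Finset.sum_le_sum fun s _ => ?_
    rw [← sub_nonneg, ← map_sub]
    refine expectation_nonneg v ?_
    -- Each summand is a tensor product of positive operators, since `α - α * α` and `γ - γ * γ` are
    -- positive.
    have e : a x s * b x s - a x s * a x s * (b x s * b x s) =
        ((α x s - α x s * α x s) ⊗ₖ 1) ⊗ₖ (γ x s ⊗ₖ 1) +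
          ((α x s * α x s) ⊗ₖ 1) ⊗ₖ ((γ x s - γ x s * γ x s) ⊗ₖ 1) := by
      simp only [ha, hb, ← Matrix.mul_kronecker_mul, mul_one, one_mul, sub_eq_add_neg,
        Matrix.add_kronecker, Matrix.kronecker_add]
      ext i j
      simp only [Matrix.add_apply, Matrix.neg_apply, Matrix.kroneckerMap_apply]
      ring
    rw [e]
    have h1 : (α x s * α x s).PosSemidef := by rw [hαP]; exact (hP x).posSemidef s
    exact (((hα1 x s).kronecker .one).kronecker ((hγ x s).kronecker .one)).add
      ((h1.kronecker .one).kronecker ((hγ1 x s).kronecker .one))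
  have main := exp_moment_le hn G (expectation_star_mul_self_nonneg v) (a := a) (b := b) (r := r)
    (fun x s => hself (((hα x s).kronecker .one).kronecker .one))
    (fun x s => hself (Matrix.PosSemidef.one.kronecker ((hγ x s).kronecker .one)))
    (fun y t => hself ((Matrix.PosSemidef.one.kronecker (hβ y t)).kronecker .one))
    (fun x => by
      simp only [ha, ← Matrix.mul_kronecker_mul, mul_one, hαP, ← sum_kronecker,
        (hP x).sum_eq_one, Matrix.one_kronecker_one])
    (fun x => by
      simp only [hb, ← Matrix.mul_kronecker_mul, mul_one, hγP, ← sum_kronecker,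
        ← kronecker_sum, (hP' x).map_conj.sum_eq_one, Matrix.one_kronecker_one])
    (fun y => by
      simp only [hr, ← Matrix.mul_kronecker_mul, mul_one, hβP, ← sum_kronecker,
        ← kronecker_sum, (hR y).sum_eq_one, Matrix.one_kronecker_one])
    (fun x s x' s' => by
      simp only [ha, hb, Commute, SemiconjBy, ← Matrix.mul_kronecker_mul, mul_one, one_mul])
    (fun x s y t => by
      simp only [ha, hr, Commute, SemiconjBy, ← Matrix.mul_kronecker_mul, mul_one, one_mul])
    (fun x s y t => by
      simp only [hb, hr, Commute, SemiconjBy, ← Matrix.mul_kronecker_mul, mul_one, one_mul])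
    hle hδ hδ1
  refine le_of_eq_of_le ?_ main
  refine Finset.sum_congr rfl fun x _ => Finset.sum_congr rfl fun y _ =>
    Finset.sum_congr rfl fun s _ => Finset.sum_congr rfl fun t _ => ?_
  -- The adversary's copy `t'` of Bob's output does not enter the score, so her measurement `R'` is
  -- summed out.
  rw [← Finset.mul_sum, ← map_sum]
  congr 2
  simp only [map_conj_kronecker, ← kronecker_sum, (hR' y).map_conj.sum_eq_one]
  simp only [ha, hb, hr, ← Matrix.mul_kronecker_mul, mul_one, one_mul, hαP, hβP, hγP]

/-! ### Marginals of sequential strategies and their conditional strategies. -/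

section Strategies

variable {Q : Type*} [Fintype Q] [DecidableEq Q]

/-- A matrix has finite spectrum, on which every function is continuous. -/
lemma cfc_mul_cfc (f g : ℝ → ℝ) (M : Matrix Q Q ℂ) :
    cfc f M * cfc g M = cfc (fun x => f x * g x) M :=
  (cfc_mul f g M (M.finite_real_spectrum.continuousOn f)
    (M.finite_real_spectrum.continuousOn g)).symm

open scoped MatrixOrder in
lemma cfc_congr_of_posSemidef {M : Matrix Q Q ℂ} (hM : M.PosSemidef) {f g : ℝ → ℝ}
    (h : ∀ x, 0 ≤ x → f x = g x) : cfc f M = cfc g M :=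
  cfc_congr fun x hx =>
    h x (spectrum_nonneg_of_nonneg (Matrix.nonneg_iff_posSemidef.2 hM) hx)

lemma supportProj_mul_self {M : Matrix Q Q ℂ} (hM : M.PosSemidef) : supportProj M * M = M := by
  have hsa : IsSelfAdjoint M := hM.1
  have h : cfc (fun x : ℝ => x) M = M := cfc_id' ℝ M
  calc supportProj M * M = supportProj M * cfc (fun x : ℝ => x) M := by rw [h]
    _ = cfc (fun x : ℝ => x) M := by
      rw [supportProj, cfc_mul_cfc]
      exact cfc_congr_of_posSemidef hM fun x _ => by by_cases hx : x = 0 <;> simp [hx]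
    _ = M := h

lemma sqrt_mul_sqrt_self {M : Matrix Q Q ℂ} (hM : M.PosSemidef) :
    cfc Real.sqrt M * cfc Real.sqrt M = M := by
  have hsa : IsSelfAdjoint M := hM.1
  conv_rhs => rw [← cfc_id' ℝ M]
  rw [cfc_mul_cfc]
  exact cfc_congr_of_posSemidef hM fun x hx => Real.mul_self_sqrt hx

lemma sqrt_mul_invSqrt {M : Matrix Q Q ℂ} (hM : M.PosSemidef) :
    cfc Real.sqrt M * invSqrt M = supportProj M := by
  rw [invSqrt, supportProj, cfc_mul_cfc]
  refine cfc_congr_of_posSemidef hM fun x hx => ?_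
  rcases hx.eq_or_lt with rfl | hx
  · simp
  · simp [hx.ne', mul_inv_cancel₀ (Real.sqrt_pos.2 hx).ne']

lemma invSqrt_mul_sqrt {M : Matrix Q Q ℂ} (hM : M.PosSemidef) :
    invSqrt M * cfc Real.sqrt M = supportProj M := by
  rw [← sqrt_mul_invSqrt hM, invSqrt, cfc_mul_cfc, cfc_mul_cfc]
  simp only [mul_comm]

lemma sqrt_mul_supportProj {M : Matrix Q Q ℂ} (hM : M.PosSemidef) :
    cfc Real.sqrt M * supportProj M = cfc Real.sqrt M := by
  rw [supportProj, cfc_mul_cfc]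
  exact cfc_congr_of_posSemidef hM fun x _ => by by_cases hx : x = 0 <;> simp [hx]

lemma supportProj_mul_sqrt {M : Matrix Q Q ℂ} (hM : M.PosSemidef) :
    supportProj M * cfc Real.sqrt M = cfc Real.sqrt M := by
  rw [supportProj, cfc_mul_cfc]
  exact cfc_congr_of_posSemidef hM fun x _ => by by_cases hx : x = 0 <;> simp [hx]

lemma isHermitian_cfc (f : ℝ → ℝ) (M : Matrix Q Q ℂ) : (cfc f M).IsHermitian :=
  IsSelfAdjoint.cfc

/-- A positive operator below `M` lives on the support of `M`. -/
lemma mul_supportProj_of_le {M M' : Matrix Q Q ℂ} (hM : M.PosSemidef) (hM' : M'.PosSemidef)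
    (hle : (M - M').PosSemidef) : M' * supportProj M = M' := by
  set C := 1 - supportProj M with hC
  have hCh : Cᴴ = C := by
    rw [hC, Matrix.conjTranspose_sub, Matrix.conjTranspose_one]
    exact congrArg _ (isHermitian_cfc _ M)
  have hCM : C * M = 0 := by rw [hC, sub_mul, one_mul, supportProj_mul_self hM, sub_self]
  obtain ⟨K, rfl⟩ : ∃ K : Matrix Q Q ℂ, M' = Kᴴ * K := by
    refine ⟨cfc Real.sqrt M', ?_⟩
    rw [isHermitian_cfc, sqrt_mul_sqrt_self hM']
  -- Compressing `M - M'` to the kernel of `M` leaves minus a positive operator, which must then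
  -- vanish.
  have h1 : (-((K * C)ᴴ * (K * C))).PosSemidef := by
    have h := hle.conjTranspose_mul_mul_same C
    rw [hCh, mul_sub C M, hCM, zero_sub, neg_mul] at h
    rwa [Matrix.conjTranspose_mul, hCh, ← mul_assoc, mul_assoc C]
  have h2 : ((K * C)ᴴ * (K * C)).trace = 0 := by
    have h3 := (Matrix.posSemidef_conjTranspose_mul_self (K * C)).trace_nonneg
    have h4 := h1.trace_nonneg
    rw [Matrix.trace_neg, neg_nonneg] at h4
    exact le_antisymm h4 h3
  have h5 : K * C = 0 := Matrix.trace_conjTranspose_mul_self_eq_zero_iff.1 h2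
  have h6 : Kᴴ * K * C = 0 := by rw [mul_assoc, h5, mul_zero]
  rw [hC, mul_sub, mul_one, sub_eq_zero] at h6
  exact h6.symm

lemma supportProj_mul_of_le {M M' : Matrix Q Q ℂ} (hM : M.PosSemidef) (hM' : M'.PosSemidef)
    (hle : (M - M').PosSemidef) : supportProj M * M' = M' := by
  have h := congrArg Matrix.conjTranspose (mul_supportProj_of_le hM hM' hle)
  rwa [Matrix.conjTranspose_mul, hM'.1.eq, supportProj, isHermitian_cfc] at h

variable {U T : Type*} [Fintype T] [DecidableEq T] {N : ℕ}
  {F : (Fin N → U) → (Fin N → T) → Matrix Q Q ℂ}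

lemma marginal_posSemidef (hF : IsSequential F) (i : ℕ) (u : Fin N → U) (t : Fin N → T) :
    (marginal F i u t).PosSemidef :=
  Matrix.posSemidef_sum _ fun t' _ => (hF.isMeasurement u).posSemidef t'

omit [Fintype Q] [DecidableEq Q] in
lemma marginal_all (u : Fin N → U) (t : Fin N → T) : marginal F N u t = F u t := by
  have : (Finset.univ.filter fun t' : Fin N → T => ∀ j : Fin N, (j : ℕ) < N → t' j = t j) =
      {t} := by
    ext t'
    simp [funext_iff]
  rw [marginal, this, Finset.sum_singleton]

lemma marginal_zero (hF : IsSequential F) (u : Fin N → U) (t : Fin N → T) :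
    marginal F 0 u t = 1 := by
  simp [marginal, (hF.isMeasurement u).sum_eq_one]

omit [Fintype Q] [DecidableEq Q] in
lemma sum_marginal_update (i : Fin N) (u : Fin N → U) (t : Fin N → T) :
    ∑ w, marginal F (i + 1) u (Function.update t i w) = marginal F i u t := by
  simp only [marginal, Finset.sum_filter]
  rw [Finset.sum_comm]
  refine Finset.sum_congr rfl fun t' _ => ?_
  have h : ∀ w, (∀ j : Fin N, (j : ℕ) < i + 1 → t' j = Function.update t i w j) ↔
      t' i = w ∧ ∀ j : Fin N, (j : ℕ) < i → t' j = t j := by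
    intro w
    constructor
    · intro h
      refine ⟨by simpa using h i (Nat.lt_succ_self _), fun j hj => ?_⟩
      have := h j (Nat.lt_succ_of_lt hj)
      rwa [Function.update_of_ne (Fin.ne_of_lt hj)] at this
    · rintro ⟨rfl, h⟩ j hj
      rcases Nat.lt_succ_iff_lt_or_eq.1 hj with hj | hj
      · rw [Function.update_of_ne (Fin.ne_of_lt hj), h j hj]
      · rw [Fin.ext hj, Function.update_self]
  simp only [h, ite_and, Finset.sum_ite_eq, Finset.mem_univ, if_true]

lemma marginal_sub_marginal_posSemidef (hF : IsSequential F) (i : Fin N) (u : Fin N → U)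
    (t : Fin N → T) (v : U) (w : T) :
    (marginal F i u t -
      marginal F (i + 1) (Function.update u i v) (Function.update t i w)).PosSemidef := by
  have h : marginal F i u t = marginal F i (Function.update u i v) t :=
    hF.nonanticipating i _ _ (fun j hj => by rw [Function.update_of_ne (Fin.ne_of_lt hj)]) t
  rw [h, ← sum_marginal_update, ← Finset.sum_erase_eq_sub (Finset.mem_univ w)]
  exact Matrix.posSemidef_sum _ fun w' _ => marginal_posSemidef hF _ _ _

/-- The normalization can be undone because the extended operator lies below the history's operator,
hence on its support. -/
lemma marginal_succ_eq_conditional (hF : IsSequential F) (i : Fin N) (u : Fin N → U)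
    (t : Fin N → T) (v : U) (w : T) :
    marginal F (i + 1) (Function.update u i v) (Function.update t i w) =
      cfc Real.sqrt (marginal F i u t) * conditional F i u t v w *
        cfc Real.sqrt (marginal F i u t) := by
  have hM := marginal_posSemidef hF i u t
  have hM' := marginal_posSemidef hF (i + 1) (Function.update u i v) (Function.update t i w)
  have hle := marginal_sub_marginal_posSemidef hF i u t v w
  rw [conditional, mul_assoc, mul_assoc, mul_assoc, invSqrt_mul_sqrt hM, ← mul_assoc,
    sqrt_mul_invSqrt hM, mul_supportProj_of_le hM hM' hle, supportProj_mul_of_le hM hM' hle]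

end Strategies

section Bipartite

variable {n N : ℕ} {A B : Type*} [Fintype A] [DecidableEq A] [Fintype B] [DecidableEq B]
  {F : (Fin N → Fin n × Fin n) → (Fin N → Fin n × Fin n) → Matrix (A × B) (A × B) ℂ}

/-- The square roots absorb the support projectors, so the local measurements appear without
compression, and histories of zero weight need no separate treatment later. -/
lemma IsBipartiteSequential.exists_local (hF : IsBipartiteSequential F) (hn : 0 < n) (i : Fin N)
    (u t : Fin N → Fin n × Fin n) :
    ∃ (P : Fin n → Fin n → Matrix A A ℂ) (R : Fin n → Fin n → Matrix B B ℂ),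
      (∀ x, IsMeasurement (P x)) ∧ (∀ y, IsMeasurement (R y)) ∧
      ∀ x y s t', marginal F (i + 1) (Function.update u i (x, y)) (Function.update t i (s, t')) =
        cfc Real.sqrt (marginal F i u t) * (P x s ⊗ₖ R y t') *
          cfc Real.sqrt (marginal F i u t) := by
  have hM := marginal_posSemidef hF.isSequential i u t
  by_cases h0 : marginal F i u t = 0
  -- For a zero history both sides vanish, and the measurement that always answers `0` serves.
  · have key : ∀ {K : Type _} [Fintype K] [DecidableEq K], IsMeasurement
        fun s : Fin n => if s = ⟨0, hn⟩ then (1 : Matrix K K ℂ) else 0 := fun {K} _ _ =>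
      ⟨fun s => by
        show (if s = _ then (1 : Matrix K K ℂ) else 0).PosSemidef
        split_ifs
        exacts [.one, .zero], by simp⟩
    refine ⟨fun _ s => if s = ⟨0, hn⟩ then 1 else 0, fun _ s => if s = ⟨0, hn⟩ then 1 else 0,
      fun _ => key, fun _ => ?_, fun x y s t' => ?_⟩
    · exact ⟨fun s => by
        show (if s = _ then (1 : Matrix B B ℂ) else 0).PosSemidef
        split_ifs
        exacts [.one, .zero], by simp⟩
    · rw [marginal_succ_eq_conditional hF.isSequential, h0, cfc_apply_zero]
      simp
  · obtain ⟨P, R, hP, hR, h⟩ := hF.bipartite i u t h0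
    refine ⟨P, R, hP, hR, fun x y s t' => ?_⟩
    rw [marginal_succ_eq_conditional hF.isSequential, h, ← mul_assoc, ← mul_assoc,
      sqrt_mul_supportProj hM, mul_assoc _ (supportProj _), supportProj_mul_sqrt hM]

end Bipartite

/-! ### Iterating a one-round bound over histories. -/

section Induction

variable {α : Type*} [Fintype α]

/-- A supermartingale argument: summing out the last letter of each history costs a factor `κ`. -/
lemma sum_prod_mul_le_pow {N : ℕ} {c : α → ℝ} (hc : ∀ a, 0 ≤ c a) {κ : ℝ} (hκ : 0 ≤ κ)
    (h : ∀ i, (Fin i → α) → ℝ)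
    (hstep : ∀ i < N, ∀ z : Fin i → α,
      ∑ a, c a * h (i + 1) (Fin.snoc (α := fun _ => α) z a) ≤ κ * h i z)
    (i : ℕ) (hi : i ≤ N) :
    ∑ z : Fin i → α, (∏ j, c (z j)) * h i z ≤ κ ^ i * h 0 Fin.elim0 := by
  induction i with
  | zero => simp [Subsingleton.elim (default : Fin 0 → α) Fin.elim0]
  | succ i ih =>
    rw [← (Fin.snocEquiv fun _ => α).sum_comp, Fintype.sum_prod_type, Finset.sum_comm]
    calc _ = ∑ z : Fin i → α, (∏ j, c (z j)) *
          ∑ a, c a * h (i + 1) (Fin.snoc (α := fun _ => α) z a) := by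
          refine Finset.sum_congr rfl fun z _ => ?_
          rw [Finset.mul_sum]
          refine Finset.sum_congr rfl fun a _ => ?_
          have : ((Fin.snocEquiv fun _ => α) (a, z)) = Fin.snoc (α := fun _ => α) z a := rfl
          rw [this, Fin.prod_univ_castSucc]
          simp only [Fin.snoc_castSucc, Fin.snoc_last]
          ring
      _ ≤ ∑ z : Fin i → α, (∏ j, c (z j)) * (κ * h i z) :=
          Finset.sum_le_sum fun z _ => mul_le_mul_of_nonneg_left (hstep i hi z)
            (Finset.prod_nonneg fun j _ => hc _)
      _ = κ * ∑ z : Fin i → α, (∏ j, c (z j)) * h i z := by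
          rw [Finset.mul_sum]
          exact Finset.sum_congr rfl fun z _ => by ring
      _ ≤ κ * (κ ^ i * h 0 Fin.elim0) := mul_le_mul_of_nonneg_left (ih (by omega)) hκ
      _ = _ := by ring

/-- The string of length `N` that continues `z` with the letter `d`. -/
def extend (N : ℕ) (d : α) {i : ℕ} (z : Fin i → α) : Fin N → α :=
  fun j => if hj : (j : ℕ) < i then z ⟨j, hj⟩ else d

omit [Fintype α] in
lemma extend_snoc {N : ℕ} (d : α) (i : Fin N) (z : Fin i → α) (a : α) :
    extend N d (Fin.snoc (α := fun _ => α) z a) = Function.update (extend N d z) i a := by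
  funext j
  by_cases hj : j = i
  · subst hj
    simp [extend, Fin.snoc]
  · rw [Function.update_of_ne hj]
    have hne : (j : ℕ) ≠ i := fun h => hj (Fin.ext h)
    by_cases hlt : (j : ℕ) < i
    · simp [extend, Fin.snoc, hlt, Nat.lt_succ_of_lt hlt]
    · have : ¬ (j : ℕ) < i + 1 := by omega
      simp [extend, hlt, this]

omit [Fintype α] in
lemma extend_self {N : ℕ} (d : α) (z : Fin N → α) : extend N d z = z := by
  funext j
  simp [extend]

end Induction

/-! ### The exponential moment of the mirrored protocol. -/

section Protocol

variable {n N : ℕ} {Q : Type*} [Fintype Q] [DecidableEq Q]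

/-- The vector `(√ρ ⊗ I) ∑ₑ e ⊗ e`. -/
noncomputable def purificationVec (ρ : Matrix Q Q ℂ) : Q × Q → ℂ :=
  (cfc Real.sqrt ρ ⊗ₖ (1 : Matrix Q Q ℂ)) *ᵥ diagVec Q

lemma expectation_purificationVec_one {ρ : Matrix Q Q ℂ} (hρ : IsState ρ) :
    expectation (purificationVec ρ) 1 = 1 := by
  have h := expectation_conj (diagVec Q) 1 (cfc Real.sqrt ρ ⊗ₖ (1 : Matrix Q Q ℂ))
  rw [purificationVec, ← h, mul_one, Matrix.conjTranspose_kronecker, Matrix.conjTranspose_one,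
    ← Matrix.mul_kronecker_mul, mul_one, isHermitian_cfc, sqrt_mul_sqrt_self hρ.posSemidef]
  have htr : star (diagVec Q) ⬝ᵥ (ρ ⊗ₖ (1 : Matrix Q Q ℂ)) *ᵥ diagVec Q = ρ.trace := by
    simp [dotProduct, Matrix.mulVec, diagVec, Fintype.sum_prod_type, Matrix.one_apply,
      Matrix.trace, apply_ite]
  simp [expectation, htr, hρ.trace_eq_one]

lemma trace_mul_vecMulVec_star {K : Type*} [Fintype K] (Z : Matrix K K ℂ) (v : K → ℂ) :
    (Z * Matrix.vecMulVec v (star v)).trace = star v ⬝ᵥ Z *ᵥ v := by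
  rw [Matrix.mul_vecMulVec, Matrix.trace_vecMulVec, dotProduct_comm]

/-- The joint probability of the effect `M` on a register in the state `ρ` and of the conjugate of
`M'` on its purification. -/
noncomputable def jointWeight (ρ : Matrix Q Q ℂ) (M M' : Matrix Q Q ℂ) : ℝ :=
  expectation (purificationVec ρ) (M ⊗ₖ M'.map (starRingEnd ℂ))

/-- Measuring both halves of the Bell state in the standard basis yields one uniformly random
string, seen by both sides. -/
lemma recordProb_eq (ρ : Matrix Q Q ℂ) (F : Pairs n N → Pairs n N → Matrix Q Q ℂ)
    (r : Record n N) : recordProb ρ F r =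
      if r.inp = r.inp' then
        (Fintype.card (Pairs n N) : ℝ)⁻¹ * jointWeight ρ (F r.inp r.out) (F r.inp' r.out')
      else 0 := by
  have hpur : canonicalPurification ρ =
      Matrix.vecMulVec (purificationVec ρ) (star (purificationVec ρ)) := rfl
  have hbell : (Matrix.single (r.inp, r.inp') (r.inp, r.inp') (1 : ℂ) *
      bellState (Pairs n N)).trace =
      if r.inp = r.inp' then (Fintype.card (Pairs n N) : ℂ)⁻¹ else 0 := by
    rw [bellState, Matrix.mul_smul, Matrix.trace_smul, trace_mul_vecMulVec_star,
      Matrix.single_mulVec_eq]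
    by_cases h : r.inp = r.inp' <;> simp [diagVec, h]
  rw [recordProb, recordEffect, initialState, ← Matrix.mul_kronecker_mul, Matrix.trace_kronecker,
    Matrix.single_kronecker_single, mul_one, hbell, hpur, trace_mul_vecMulVec_star]
  split_ifs
  · rw [← Complex.ofReal_natCast, ← Complex.ofReal_inv, Complex.re_ofReal_mul]
    rfl
  · simp

lemma jointWeight_nonneg {ρ M M' : Matrix Q Q ℂ} (hM : M.PosSemidef) (hM' : M'.PosSemidef) :
    0 ≤ jointWeight ρ M M' :=
  expectation_nonneg _ (hM.kronecker (posSemidef_map_conj hM'))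

/-- Records as quadruples of strings. -/
def recordEquiv (n N : ℕ) : (Pairs n N × Pairs n N) × (Pairs n N × Pairs n N) ≃ Record n N where
  toFun p := ⟨p.1.1, p.2.1, p.1.2, p.2.2⟩
  invFun r := ((r.inp, r.inp'), (r.out, r.out'))
  left_inv _ := rfl
  right_inv _ := rfl

open Classical in
lemma prob_eq (ρ : Matrix Q Q ℂ) (F : Pairs n N → Pairs n N → Matrix Q Q ℂ)
    (E : Record n N → Prop) :
    prob ρ F E = ∑ u, ∑ t, ∑ t', if E ⟨u, t, u, t'⟩ then
      (Fintype.card (Pairs n N) : ℝ)⁻¹ * jointWeight ρ (F u t) (F u t') else 0 := by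
  rw [prob, Finset.sum_filter, ← (recordEquiv n N).sum_comp, Fintype.sum_prod_type,
    Fintype.sum_prod_type]
  refine Finset.sum_congr rfl fun u _ => ?_
  rw [Finset.sum_eq_single u]
  · simp [recordEquiv, recordProb_eq, Fintype.sum_prod_type]
  · intro u' _ hne
    refine Finset.sum_eq_zero fun p _ => ?_
    simp [recordEquiv, recordProb_eq, hne.symm]
  · simp

/-- The letters of a joint history of the devices and the adversary: the inputs, the outputs of
the devices and those of the adversary. -/
abbrev Letter (n : ℕ) := (Fin n × Fin n) × (Fin n × Fin n) × (Fin n × Fin n)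

/-- The factor contributed by one round to the exponential moment. -/
noncomputable def roundFactor (G : BellGame n) (l δ : ℝ) (a : Letter n) : ℝ :=
  ((n : ℝ) ^ 2)⁻¹ * if a.2.1.1 = a.2.2.1 then
    Real.exp (l * (G.score a.1.1 a.1.2 a.2.1.1 a.2.1.2 - δ)) else 0

lemma roundFactor_nonneg (G : BellGame n) (l δ : ℝ) (a : Letter n) : 0 ≤ roundFactor G l δ a := by
  rw [roundFactor]
  split_ifs <;> positivity

/-- Chernoff's bound. -/
lemma inv_card_le_prod_roundFactor (hN : 0 < N) (G : BellGame n) {l δ : ℝ} (hl : 0 ≤ l)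
    {u t t' : Pairs n N} (hsame : ∀ i, (t i).1 = (t' i).1) (hsucc : δ < averageScore G u t) :
    (Fintype.card (Pairs n N) : ℝ)⁻¹ ≤ ∏ i, roundFactor G l δ (u i, t i, t' i) := by
  have hcard : (Fintype.card (Pairs n N) : ℝ) = ((n : ℝ) ^ 2) ^ N := by
    simp [Pairs, sq]
  simp only [roundFactor, hsame, if_true, Finset.prod_mul_distrib, Finset.prod_const,
    Finset.card_univ, Fintype.card_fin, ← Real.exp_sum, ← Finset.mul_sum]
  rw [hcard, inv_pow]
  refine le_mul_of_one_le_right (by positivity) (Real.one_le_exp (mul_nonneg hl ?_))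
  have hN' : (0 : ℝ) < N := by exact_mod_cast hN
  rw [averageScore, lt_div_iff₀ hN'] at hsucc
  simp only [hsame] at hsucc
  simp only [Finset.sum_sub_distrib, Finset.sum_const, Finset.card_univ, Fintype.card_fin,
    nsmul_eq_mul]
  linarith

variable {A B : Type*} [Fintype A] [DecidableEq A] [Fintype B] [DecidableEq B]

/-- Given the two histories, both sides play locally on the purification vector multiplied by the
square roots of the histories' operators. The squared norm of that vector is the joint weight of the
histories, so `exp_moment_kronecker_le` applies. -/
lemma sum_roundFactor_mul_jointWeight_le (hn : 0 < n) (G : BellGame n) {δ : ℝ} (hδ : 0 < δ)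
    (hδ1 : δ ≤ 1) (ρ : Matrix (A × B) (A × B) ℂ)
    {F : Pairs n N → Pairs n N → Matrix (A × B) (A × B) ℂ} (hF : IsBipartiteSequential F)
    (i : Fin N) (u t t' : Pairs n N) :
    ∑ a, roundFactor G (δ / (16 * n ^ 2)) δ a *
      jointWeight ρ (marginal F (i + 1) (Function.update u i a.1) (Function.update t i a.2.1))
        (marginal F (i + 1) (Function.update u i a.1) (Function.update t' i a.2.2)) ≤
      (1 - δ ^ 2 / (32 * n ^ 2)) * jointWeight ρ (marginal F i u t) (marginal F i u t') := by
  obtain ⟨P, R, hP, hR, h⟩ := hF.exists_local hn i u t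
  -- The histories `t` and `t'` may differ, so the adversary's local measurements need not be
  -- conjugates of those of the devices.
  obtain ⟨P', R', hP', hR', h'⟩ := hF.exists_local hn i u t'
  set m := cfc Real.sqrt (marginal F i u t) with hm
  set m' := cfc Real.sqrt (marginal F i u t') with hm'
  have hmm : m * m = marginal F i u t :=
    sqrt_mul_sqrt_self (marginal_posSemidef hF.isSequential i u t)
  have hmm' : m' * m' = marginal F i u t' :=
    sqrt_mul_sqrt_self (marginal_posSemidef hF.isSequential i u t')
  set C := m ⊗ₖ m'.map (starRingEnd ℂ) with hC
  have hCh : Cᴴ = C := by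
    rw [hC, Matrix.conjTranspose_kronecker, isHermitian_cfc]
    congr 1
    have := congrArg (fun M => M.map (starRingEnd ℂ))
      (isHermitian_cfc Real.sqrt (marginal F i u t')).eq
    exact this
  have hweight : ∀ Z Z' : Matrix (A × B) (A × B) ℂ, jointWeight ρ (m * Z * m) (m' * Z' * m') =
      expectation (C *ᵥ purificationVec ρ) (Z ⊗ₖ Z'.map (starRingEnd ℂ)) := by
    intro Z Z'
    rw [← expectation_conj, hCh, jointWeight, hC, Matrix.map_mul, Matrix.map_mul,
      Matrix.mul_kronecker_mul, Matrix.mul_kronecker_mul]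
  have hone : expectation (C *ᵥ purificationVec ρ) 1 =
      jointWeight ρ (marginal F i u t) (marginal F i u t') := by
    rw [← hmm, ← hmm']
    have := hweight 1 1
    rw [mul_one, mul_one, Matrix.map_one _ (map_zero _) (map_one _),
      Matrix.one_kronecker_one] at this
    exact this.symm
  have main := exp_moment_kronecker_le hn G hP hP' hR hR' (C *ᵥ purificationVec ρ) hδ hδ1
  rw [hone] at main
  have hn2 : (0 : ℝ) < (n : ℝ) ^ 2 := by positivity
  calc _ = ((n : ℝ) ^ 2)⁻¹ * ∑ x, ∑ y, ∑ s, ∑ y', ∑ z',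
        Real.exp (δ / (16 * n ^ 2) * (G.score x y s y' - δ)) *
        expectation (C *ᵥ purificationVec ρ)
          ((P x s ⊗ₖ R y y') ⊗ₖ (P' x s ⊗ₖ R' y z').map (starRingEnd ℂ)) := by
          simp only [Fintype.sum_prod_type, Finset.mul_sum, h, h', hweight, roundFactor]
          refine Finset.sum_congr rfl fun x _ => Finset.sum_congr rfl fun y _ =>
            Finset.sum_congr rfl fun s _ => Finset.sum_congr rfl fun y' _ => ?_
          -- The indicator in `roundFactor` keeps only equal outputs of Alice and her copy.
          rw [Finset.sum_eq_single s]
          · simp [mul_assoc]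
          · intro s' _ hne
            simp [hne.symm]
          · simp
    _ ≤ ((n : ℝ) ^ 2)⁻¹ * (n ^ 2 * jointWeight ρ (marginal F i u t) (marginal F i u t') *
        (1 - δ ^ 2 / (32 * n ^ 2))) := mul_le_mul_of_nonneg_left main (by positivity)
    _ = _ := by field_simp

lemma averageScore_le_one (hN : 0 < N) (G : BellGame n) (u t : Pairs n N) :
    averageScore G u t ≤ 1 := by
  have hN' : (0 : ℝ) < N := by exact_mod_cast hN
  rw [averageScore, div_le_one hN']
  calc _ ≤ ∑ _i : Fin N, (1 : ℝ) := Finset.sum_le_sum fun i _ => (G.score_mem _ _ _ _).2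
    _ = N := by simp

/-- The success probability in terms of the squared gap only. -/
theorem prob_sameOutput_le (hn : 0 < n) (G : BellGame n) {δ : ℝ} (hδ : 0 < δ) (hδ1 : δ ≤ 1)
    (hN : 0 < N) {ρ : Matrix (A × B) (A × B) ℂ} (hρ : IsState ρ)
    {F : Pairs n N → Pairs n N → Matrix (A × B) (A × B) ℂ} (hF : IsBipartiteSequential F) :
    prob ρ F (fun r => SameOutput r ∧ RefereeSucc G δ r ∧ AdversarySucc G δ r) ≤
      (1 - δ ^ 2 / (32 * n ^ 2)) ^ N := by
  classical
  have hn1 : (1 : ℝ) ≤ n := by exact_mod_cast hn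
  set l : ℝ := δ / (16 * n ^ 2) with hl
  have hl0 : 0 ≤ l := by positivity
  have hκ : 0 ≤ 1 - δ ^ 2 / (32 * (n : ℝ) ^ 2) := by
    rw [sub_nonneg, div_le_one (by positivity)]
    nlinarith
  let o : Fin n := ⟨0, hn⟩
  -- An arbitrary filler: the weight of a history of length `i` sees only its first `i` letters.
  let d : Letter n := ((o, o), (o, o), (o, o))
  let h : ∀ i, (Fin i → Letter n) → ℝ := fun i z =>
    jointWeight ρ (marginal F i (fun j => (extend N d z j).1) fun j => (extend N d z j).2.1)
      (marginal F i (fun j => (extend N d z j).1) fun j => (extend N d z j).2.2)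
  have hstep : ∀ i < N, ∀ z : Fin i → Letter n, ∑ a, roundFactor G l δ a *
      h (i + 1) (Fin.snoc (α := fun _ => Letter n) z a) ≤
      (1 - δ ^ 2 / (32 * n ^ 2)) * h i z := by
    intro i hi z
    have key := sum_roundFactor_mul_jointWeight_le hn G hδ hδ1 ρ hF ⟨i, hi⟩
      (fun j => (extend N d z j).1) (fun j => (extend N d z j).2.1)
      (fun j => (extend N d z j).2.2)
    have hupd : ∀ {β : Type} (f : Letter n → β) (a : Letter n),
        (fun j => f (extend N d (Fin.snoc (α := fun _ => Letter n) z a) j)) =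
          Function.update (fun j => f (extend N d z j)) ⟨i, hi⟩ (f a) := by
      intro β f a
      rw [extend_snoc d ⟨i, hi⟩ z a]
      exact Function.comp_update f _ _ _
    have hh : ∀ a, h (i + 1) (Fin.snoc (α := fun _ => Letter n) z a) = jointWeight ρ
        (marginal F (i + 1) (Function.update (fun j => (extend N d z j).1) ⟨i, hi⟩ a.1)
          (Function.update (fun j => (extend N d z j).2.1) ⟨i, hi⟩ a.2.1))
        (marginal F (i + 1) (Function.update (fun j => (extend N d z j).1) ⟨i, hi⟩ a.1)
          (Function.update (fun j => (extend N d z j).2.2) ⟨i, hi⟩ a.2.2)) := by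
      intro a
      simp only [h]
      rw [hupd (fun a => a.1) a, hupd (fun a => a.2.1) a, hupd (fun a => a.2.2) a]
    simp only [hh]
    exact key
  have hpow := sum_prod_mul_le_pow (roundFactor_nonneg G l δ) hκ h hstep N le_rfl
  have h0 : h 0 Fin.elim0 = 1 := by
    simp only [h, marginal_zero hF.isSequential, jointWeight]
    rw [Matrix.map_one _ (map_zero _) (map_one _), Matrix.one_kronecker_one,
      expectation_purificationVec_one hρ]
  rw [h0, mul_one] at hpow
  refine le_trans ?_ hpow
  have hreindex : ∑ z : Fin N → Letter n, (∏ j, roundFactor G l δ (z j)) * h N z =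
      ∑ u, ∑ t, ∑ t', (∏ j, roundFactor G l δ (u j, t j, t' j)) *
        jointWeight ρ (F u t) (F u t') := by
    let e : Pairs n N × Pairs n N × Pairs n N ≃ (Fin N → Letter n) :=
      { toFun := fun p j => (p.1 j, p.2.1 j, p.2.2 j)
        invFun := fun z => (fun j => (z j).1, fun j => (z j).2.1, fun j => (z j).2.2)
        left_inv := fun _ => rfl
        right_inv := fun _ => rfl }
    rw [← e.sum_comp, Fintype.sum_prod_type]
    simp only [Fintype.sum_prod_type, h, extend_self, marginal_all]
    rfl
  rw [hreindex, prob_eq]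
  -- Markov's inequality term by term: on the event the product of round factors is at least the
  -- input probability, and elsewhere it is nonnegative.
  refine Finset.sum_le_sum fun u _ => Finset.sum_le_sum fun t _ => Finset.sum_le_sum fun t' _ => ?_
  have hw : 0 ≤ jointWeight ρ (F u t) (F u t') :=
    jointWeight_nonneg ((hF.isSequential.isMeasurement u).posSemidef t)
      ((hF.isSequential.isMeasurement u).posSemidef t')
  split_ifs with hE
  · exact mul_le_mul_of_nonneg_right
      (inv_card_le_prod_roundFactor hN G hl0 hE.1 hE.2.1) hw
  · exact mul_nonneg (Finset.prod_nonneg fun j _ => roundFactor_nonneg G l δ _) hw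

end Protocol
end MirrorProtocol

/-! ### The stated exponential bound. -/

theorem mainTheorem2 :
    ∃ c : ℝ, 0 < c ∧
      ∀ (n : ℕ), 0 < n → ∀ (G : MirrorProtocol.BellGame n) (δ : ℝ), 0 < δ →
      ∀ (N : ℕ), 0 < N →
      ∀ (A B : Type*) [Fintype A] [DecidableEq A] [Fintype B] [DecidableEq B]
        (ρ : Matrix (A × B) (A × B) ℂ), MirrorProtocol.IsState ρ →
      ∀ (F : (Fin N → Fin n × Fin n) → (Fin N → Fin n × Fin n) → Matrix (A × B) (A × B) ℂ),
        MirrorProtocol.IsBipartiteSequential F →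
        MirrorProtocol.prob ρ F (fun r => MirrorProtocol.SameOutput r ∧
            MirrorProtocol.RefereeSucc G δ r ∧ MirrorProtocol.AdversarySucc G δ r) ≤
          Real.exp (-(c * ((N : ℝ) * δ ^ 6 / (n : ℝ) ^ 4))) := by
  refine ⟨1 / 32, by norm_num, fun n hn G δ hδ N hN A B _ _ _ _ ρ hρ F hF => ?_⟩
  rcases le_or_gt δ 1 with hδ1 | hδ1
  · refine (MirrorProtocol.prob_sameOutput_le hn G hδ hδ1 hN hρ hF).trans ?_
    have hn1 : (1 : ℝ) ≤ n := by exact_mod_cast hn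
    have hn2 : (1 : ℝ) ≤ (n : ℝ) ^ 2 := one_le_pow₀ hn1
    have hκ : 0 ≤ 1 - δ ^ 2 / (32 * (n : ℝ) ^ 2) := by
      rw [sub_nonneg, div_le_one (by positivity)]
      nlinarith
    have hexp : 1 - δ ^ 2 / (32 * (n : ℝ) ^ 2) ≤ Real.exp (-(δ ^ 2 / (32 * (n : ℝ) ^ 2))) := by
      have := Real.add_one_le_exp (-(δ ^ 2 / (32 * (n : ℝ) ^ 2)))
      linarith
    refine (pow_le_pow_left₀ hκ hexp N).trans ?_
    rw [← Real.exp_nat_mul, Real.exp_le_exp, mul_neg, neg_le_neg_iff]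
    -- The exponent obtained is `N * δ ^ 2 / (32 * n ^ 2)`; for `δ ≤ 1 ≤ n` it dominates the
    -- required one with `c = 1 / 32`.
    have hfrac : δ ^ 6 / (n : ℝ) ^ 4 ≤ δ ^ 2 / (n : ℝ) ^ 2 :=
      div_le_div₀ (by positivity) (pow_le_pow_of_le_one hδ.le hδ1 (by norm_num))
        (by positivity) (pow_le_pow_right₀ hn1 (by norm_num))
    calc (1 / 32 : ℝ) * (N * δ ^ 6 / (n : ℝ) ^ 4) = N / 32 * (δ ^ 6 / (n : ℝ) ^ 4) := by ring
      _ ≤ N / 32 * (δ ^ 2 / (n : ℝ) ^ 2) := mul_le_mul_of_nonneg_left hfrac (by positivity)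
      _ = N * (δ ^ 2 / (32 * (n : ℝ) ^ 2)) := by field_simp
  -- An average score never exceeds one, so for `δ > 1` the referee cannot succeed.
  · have hempty : ∀ r, ¬ (MirrorProtocol.SameOutput r ∧ MirrorProtocol.RefereeSucc G δ r ∧
        MirrorProtocol.AdversarySucc (N := N) G δ r) := fun r hr =>
      absurd (hr.2.1.trans_le (MirrorProtocol.averageScore_le_one hN G r.inp r.out))
        (not_lt.2 hδ1.le)
    rw [MirrorProtocol.prob]
    refine (Finset.sum_eq_zero fun r hr => ?_).trans_le (Real.exp_pos _).le
    simp only [Finset.mem_filter] at hr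
    exact absurd hr.2 (hempty r)
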